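/- Let $M$ be a compact smooth manifold of dimension $2n$, let $TM\oplus T^*M$ carry the pairing $\langle X+\xi,Y+\eta\rangle=\tfrac12(\xi(Y)+\eta(X))$ and the (untwisted, $H=0$) Dorfman bracket $[X+\xi,Y+\eta]=[X,Y]+\mathcal L_X\eta-i_Yd\xi$, and let $J$ be a generalized complex structure on it: a real orthogonal endomorphism with $J^2=-1$ whose $+i$-eigenbundle $L$ is closed under the bracket. Let $K$ be the bundle of complex forms annihilated by $L$ under the Clifford action $(X+\xi)\rho=i_X\rho+\xi\wedge\rho$, let $U_k$ $(-n\le k\le n)$ be the image of $\wedge^{k+n}L^*\otimes K$ under the Clifford action (with $L^*\cong\overline L$), and let $\partial,\bar\partial$ be the components of $d$ of degree $-1,+1$ with respect to $U_{-n}\oplus\dots\oplus U_n$. Assume that * $J$ is of symplectic type: $\xi\mapsto\rho(J\xi)$ is an isomorphism $T^*M\to TM$, where $\rho:TM\oplus T^*M\to TM$ is the projection; * the $\partial\bar\partial$-lemma holds: $\operatorname{Im}\partial\cap\operatorname{Ker}\bar\partial=\operatorname{Im}\bar\partial\cap\operatorname{Ker}\partial=\operatorname{Im}\partial\bar\partial$.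 For $p\in\mathbb Z$ let $F^pH(M)\subseteq H^*(M,\mathbb C)$ be the space of classes that have a closed representative which is a sum of terms in $U_j$ with $j\le p$, $j\equiv p\pmod 2$. Then there are real $2$-forms $\omega,B$, with $\omega$ nondegenerate, such that $$J=e^{B}\begin{pmatrix}0&-\omega^{-1}\\ \omega&0\end{pmatrix}e^{-B},\qquad e^{B}(X+\xi)=X+\xi+i_XB,$$ and for any such $\omega,B$ the complex $2$-form $\sigma=\omega+iB$ is closed and, for every $p\in\mathbb Z$, $F^pH(M)$ lies in the part of $H^*(M,\mathbb C)$ of degree parity $p+n$ and $$F^pH(M)=e^{i\sigma}\bigl(H^{p+n}(M,\mathbb C)\oplus H^{p+n-2}(M,\mathbb C)\oplus H^{p+n-4}(M,\mathbb C)\oplus\cdots\bigr),$$ where $e^{i\sigma}$ acts by cup product with $\sum_j(i[\sigma])^j/j!$ and $H^k(M,\mathbb C)=0$ for $k<0$. Consequently the filtration is determined by the graded cohomology ring and the class $[\sigma]$: if $M',J',\sigma'$ is another such manifold of dimension $2n$, and $\Phi:H^*(M,\mathbb C)\to H^*(M',\mathbb C)$ is an isomorphism of graded rings ($\mathbb C$-linear)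 with $\Phi[\sigma]=[\sigma']$, then $\Phi(F^pH(M))=F^pH(M')$ for all $p$. -/

import Mathlib

open scoped ContDiff Manifold
noncomputable section


/-- The complex vector fields of a commutative `ℂ`-algebra `A`, as derivations of `A`. For the algebra
of complex smooth functions on a compact manifold they are the sections of `TM ⊗ ℂ`. -/
abbrev VField (A : Type*) [CommRing A] [Algebra ℂ A] : Type _ := Derivation ℂ A A

/-- The `p`-forms: `A`-multilinear alternating functions of `p` vector fields. For the algebra of
complex smooth functions on a compact manifold they are the sections of `∧^p T^*M ⊗ ℂ`. -/
abbrev DForm (A : Type*) [CommRing A] [Algebra ℂ A] (p : ℕ) : Type _ :=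
  VField A [⋀^Fin p]→ₗ[A] A

namespace DForm

variable {A : Type*} [CommRing A] [Algebra ℂ A]

theorem lie_smul_right (X Y : VField A) (f : A) : ⁅X, f • Y⁆ = X f • Y + f • ⁅X, Y⁆ := by
  ext g
  simp [Derivation.commutator_apply]
  ring

theorem lie_smul_left (X Y : VField A) (f : A) : ⁅f • X, Y⁆ = f • ⁅X, Y⁆ - Y f • X := by
  ext g
  simp [Derivation.commutator_apply]
  ring

/-- The Lie derivative `L_X α` of a `p`-form. -/
def lieD {p : ℕ} (X : VField A) (α : DForm A p) : DForm A p where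
  toFun v := X (α v) - ∑ j : Fin p, α (Function.update v j ⁅X, v j⁆)
  map_update_add' := by
    intro inst v i x y
    obtain rfl := Subsingleton.elim inst (instDecidableEqFin p)
    have key : ∀ j, α (Function.update (Function.update v i (x + y)) j
          ⁅X, Function.update v i (x + y) j⁆) =
        α (Function.update (Function.update v i x) j ⁅X, Function.update v i x j⁆) +
        α (Function.update (Function.update v i y) j ⁅X, Function.update v i y j⁆) := by
      intro j
      by_cases h : j = i
      · subst h; simp [lie_add, α.map_update_add]
      · simp only [Function.update_of_ne h]
        rw [Function.update_comm (Ne.symm h), Function.update_comm (Ne.symm h),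
          Function.update_comm (Ne.symm h), α.map_update_add]
    simp only [key, Finset.sum_add_distrib, α.map_update_add, map_add]
    ring
  map_update_smul' := by
    intro inst v i f x
    obtain rfl := Subsingleton.elim inst (instDecidableEqFin p)
    have key : ∀ j, α (Function.update (Function.update v i (f • x)) j
          ⁅X, Function.update v i (f • x) j⁆) =
        f * α (Function.update (Function.update v i x) j ⁅X, Function.update v i x j⁆) +
        if j = i then X f * α (Function.update v i x) else 0 := by
      intro j
      by_cases h : j = i
      · subst h
        simp [α.map_update_add, α.map_update_smul]
      · simp only [Function.update_of_ne h, if_neg h]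
        rw [Function.update_comm (Ne.symm h), Function.update_comm (Ne.symm h),
          α.map_update_smul]
        simp
    simp only [key, Finset.sum_add_distrib, α.map_update_smul, Finset.sum_ite_eq',
      Finset.mem_univ, if_true, ← Finset.mul_sum, smul_eq_mul, Derivation.leibniz]
    ring
  map_eq_zero_of_eq' := by
    intro v i j h hij
    have hs : ∑ k : Fin p, α (Function.update v k ⁅X, v k⁆) =
        α (Function.update v i ⁅X, v i⁆) + α (Function.update v j ⁅X, v j⁆) := by
      refine Fintype.sum_eq_add _ _ hij fun k ⟨hki, hkj⟩ ↦ ?_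
      refine α.map_eq_zero_of_eq _ ?_ hij
      rw [Function.update_of_ne hki.symm, Function.update_of_ne hkj.symm, h]
    have hsw : Function.update v j ⁅X, v j⁆ =
        Function.update v i ⁅X, v i⁆ ∘ Equiv.swap i j := by
      ext1 k
      by_cases hkj : k = j
      · subst hkj; simp [h]
      · by_cases hki : k = i
        · subst hki; simp [Function.update_of_ne hij, h, Function.update_of_ne hij.symm]
        · simp [Equiv.swap_apply_of_ne_of_ne hki hkj, Function.update_of_ne hkj,
            Function.update_of_ne hki]
    rw [hs, hsw, α.map_swap _ hij, α.map_eq_zero_of_eq v h hij]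
    simp

theorem lieD_apply {p : ℕ} (X : VField A) (α : DForm A p) (v : Fin p → VField A) :
    lieD X α v = X (α v) - ∑ j : Fin p, α (Function.update v j ⁅X, v j⁆) := rfl

/-- The value `dα(v₀,…,vₚ)` by the invariant formula
`∑ᵢ (-1)^i vᵢ(α(…,v̂ᵢ,…)) + ∑_{i<j} (-1)^(i+j) α([vᵢ,vⱼ],…,v̂ᵢ,…,v̂ⱼ,…)`; here `[vᵢ,vⱼ]` stands in the
place of `vⱼ`, and after the removal of `vᵢ` the vectors `vⱼ` with `j > i` are those with index
`≥ i`. -/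
def koszul {p : ℕ} (α : DForm A p) (v : Fin (p + 1) → VField A) : A :=
  ∑ i : Fin (p + 1), (-1) ^ (i : ℕ) *
    (v i (α (i.removeNth v)) - ∑ j : Fin p with i ≤ j.castSucc,
      α (Function.update (i.removeNth v) j ⁅v i, i.removeNth v j⁆))

theorem koszul_cons {p : ℕ} (α : DForm A (p + 1)) (X : VField A) (w : Fin (p + 1) → VField A) :
    koszul α (Matrix.vecCons X w) = lieD X α w - koszul (α.curryLeft X) w := by
  rw [koszul, Fin.sum_univ_succ, koszul, lieD_apply, sub_eq_add_neg _ (∑ i, _),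
    ← Finset.sum_neg_distrib]
  congr 1
  · simp [Fin.removeNth]
  · refine Finset.sum_congr rfl fun i _ => ?_
    have h1 : (i.succ.removeNth (Matrix.vecCons X w) : Fin (p+1) → VField A)
        = Matrix.vecCons X (i.removeNth w) := by
      ext1 k
      refine Fin.cases ?_ (fun k => ?_) k <;> simp [Fin.removeNth]
    rw [h1]
    simp only [Finset.sum_filter]
    rw [Fin.sum_univ_succ]
    have h2 : ∀ (k : Fin p) (Z : VField A),
        Function.update (Matrix.vecCons X (i.removeNth w) : Fin (p+1) → VField A) k.succ Z
        = Matrix.vecCons X (Function.update (i.removeNth w) k Z) := fun k Z => by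
      rw [Matrix.vecCons, Matrix.vecCons, Fin.cons_update]
    simp [h2, pow_succ]

theorem koszul_zero_deg (α : DForm A 0) (X : VField A) (w : Fin 0 → VField A) :
    koszul α (Matrix.vecCons X w) = X (α w) := by
  simp [koszul]

theorem koszul_add {p : ℕ} (α β : DForm A p) (v : Fin (p + 1) → VField A) :
    koszul (α + β) v = koszul α v + koszul β v := by
  simp only [koszul, ← Finset.sum_add_distrib]
  refine Finset.sum_congr rfl fun i _ => ?_
  simp [Finset.sum_add_distrib]
  ring

theorem koszul_fsmul {p : ℕ} (f : A) (α : DForm A p) (v : Fin (p + 1) → VField A) :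
    koszul (f • α) v = f * koszul α v +
      ∑ i : Fin (p + 1), (-1) ^ (i : ℕ) * (v i f * α (i.removeNth v)) := by
  simp only [koszul, Finset.mul_sum, ← Finset.sum_add_distrib]
  refine Finset.sum_congr rfl fun i _ => ?_
  simp [← Finset.mul_sum]
  ring

theorem koszul_csmul {p : ℕ} (c : ℂ) (α : DForm A p) (v : Fin (p + 1) → VField A) :
    koszul (c • α) v = c • koszul α v := by
  simp only [koszul, Finset.smul_sum]
  refine Finset.sum_congr rfl fun i _ => ?_
  simp only [AlternatingMap.smul_apply, Derivation.map_smul, ← Finset.smul_sum, ← smul_sub,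
    mul_smul_comm]

theorem lieD_fsmul_left {p : ℕ} (f : A) (X : VField A) (α : DForm A (p + 1))
    (w : Fin (p + 1) → VField A) :
    lieD (f • X) α w = f * lieD X α w +
      ∑ i : Fin (p + 1), (-1) ^ (i : ℕ) * (w i f * α.curryLeft X (i.removeNth w)) := by
  have key : ∀ i : Fin (p + 1), (-1) ^ (i : ℕ) * (w i f * α.curryLeft X (i.removeNth w)) =
      w i f * α (Function.update w i X) := by
    intro i
    rw [← Fin.insertNth_removeNth, AlternatingMap.map_insertNth]
    simp
    ring
  simp only [key, lieD_apply, lie_smul_left, sub_eq_add_neg, α.map_update_add,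
    Finset.sum_add_distrib, ← neg_smul, α.map_update_smul]
  simp [← Finset.mul_sum, Finset.sum_neg_distrib]
  ring

/-- Build an alternating map from its contractions. -/
def ofCurry {p : ℕ} (f : VField A →ₗ[A] DForm A p)
    (h : ∀ X v, (∃ i, v i = X) → f X v = 0) : DForm A (p + 1) :=
  { LinearMap.uncurryLeft (M := fun _ => VField A)
      (AlternatingMap.toMultilinearMapLM (S := A) ∘ₗ f) with
    map_eq_zero_of_eq' := by
      intro v i j hv hij
      change f (v 0) (Fin.tail v) = 0
      rcases Fin.eq_zero_or_eq_succ i with rfl | ⟨i, rfl⟩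
      · rcases Fin.eq_zero_or_eq_succ j with rfl | ⟨j, rfl⟩
        · exact absurd rfl hij
        · exact h _ _ ⟨j, hv.symm⟩
      · rcases Fin.eq_zero_or_eq_succ j with rfl | ⟨j, rfl⟩
        · exact h _ _ ⟨i, hv⟩
        · exact (f (v 0)).map_eq_zero_of_eq _ hv (fun h => hij (by rw [h])) }

theorem ofCurry_apply {p : ℕ} (f : VField A →ₗ[A] DForm A p) (h) (v : Fin (p + 1) → VField A) :
    ofCurry f h v = f (v 0) (Fin.tail v) := rfl

theorem lieD_cons_self {p : ℕ} (X : VField A) (α : DForm A (p + 1)) (u : Fin p → VField A) :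
    lieD X α (Matrix.vecCons X u) = lieD X (α.curryLeft X) u := by
  rw [lieD_apply, lieD_apply, Fin.sum_univ_succ]
  have h2 : ∀ (k : Fin p) (Z : VField A),
      Function.update (Matrix.vecCons X u : Fin (p + 1) → VField A) k.succ Z
      = Matrix.vecCons X (Function.update u k Z) := fun k Z => by
    rw [Matrix.vecCons, Matrix.vecCons, Fin.cons_update]
  simp [h2]

theorem koszul_zero {p : ℕ} (v : Fin (p + 1) → VField A) : koszul (0 : DForm A p) v = 0 := by
  simp [koszul]

theorem exists_extD : ∀ {p : ℕ} (α : DForm A p), ∃ β : DForm A (p + 1), ∀ v, β v = koszul α v := by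
  intro p
  induction p with
  | zero =>
    intro α
    refine ⟨ofCurry
      { toFun := fun X => AlternatingMap.constOfIsEmpty A (VField A) (Fin 0) (X (α ![]))
        map_add' := fun X Y => by ext; simp
        map_smul' := fun f X => by ext; simp } (fun X v ⟨i, _⟩ => i.elim0), fun v => ?_⟩
    rw [ofCurry_apply, ← Matrix.cons_head_tail v, koszul_zero_deg]
    simp only [LinearMap.coe_mk, AddHom.coe_mk, AlternatingMap.constOfIsEmpty_apply,
      Function.const_apply, Matrix.cons_head_tail]
    exact congrArg _ (congrArg _ (Subsingleton.elim _ _))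
  | succ p ih =>
    intro α
    choose D hD using fun X => ih (α.curryLeft X)
    refine ⟨ofCurry
      { toFun := fun X => lieD X α - D X
        map_add' := fun X Y => by
          ext v
          simp only [AlternatingMap.sub_apply, AlternatingMap.add_apply, hD, map_add, koszul_add,
            lieD_apply, add_lie, α.map_update_add, Finset.sum_add_distrib, Derivation.add_apply]
          ring
        map_smul' := fun f X => by
          ext v
          simp only [AlternatingMap.sub_apply, AlternatingMap.smul_apply, hD, map_smul,
            koszul_fsmul, lieD_fsmul_left, RingHom.id_apply, smul_eq_mul]
          ring } ?_, fun v => ?_⟩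
    · rintro X v ⟨i, rfl⟩
      rw [← Fin.insertNth_self_removeNth i v, AlternatingMap.map_insertNth]
      simp only [Fin.insertNth_self_removeNth]
      refine (congrArg _ ?_).trans (smul_zero _)
      change lieD _ α _ - D _ _ = 0
      rw [hD, lieD_cons_self]
      cases p with
      | zero => rw [koszul_zero_deg]; simp [lieD_apply]
      | succ p => rw [koszul_cons, AlternatingMap.curryLeft_same, koszul_zero]; ring
    · rw [ofCurry_apply, ← Matrix.cons_head_tail v, koszul_cons]
      change lieD _ α _ - D _ _ = _
      rw [hD]
      rfl

/-- The exterior derivative of a `p`-form. -/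
def extD {p : ℕ} (α : DForm A p) : DForm A (p + 1) where
  toFun := koszul α
  map_update_add' := by
    intro _ v i x y
    obtain ⟨β, hβ⟩ := exists_extD α
    simp only [← hβ, β.map_update_add]
  map_update_smul' := by
    intro _ v i f x
    obtain ⟨β, hβ⟩ := exists_extD α
    simp only [← hβ, β.map_update_smul]
  map_eq_zero_of_eq' := by
    intro v i j h hij
    obtain ⟨β, hβ⟩ := exists_extD α
    rw [← hβ, β.map_eq_zero_of_eq v h hij]

theorem extD_apply {p : ℕ} (α : DForm A p) (v) : extD α v = koszul α v := rfl

theorem curryLeft_extD_zero (α : DForm A 0) (X : VField A) :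
    (extD α).curryLeft X = lieD X α := by
  ext w
  simp [extD_apply, koszul_zero_deg, lieD_apply]

theorem curryLeft_extD_succ {p : ℕ} (α : DForm A (p + 1)) (X : VField A) :
    (extD α).curryLeft X = lieD X α - extD (α.curryLeft X) := by
  ext w
  simp [extD_apply, koszul_cons]

/-- The wedge product `α ∧ β` of a `p`-form and a `q`-form (sum over `(p,q)`-shuffles), as a form
of degree `m = p + q`. -/
def wedge {p q m : ℕ} (h : p + q = m) (α : DForm A p) (β : DForm A q) : DForm A m :=
  ((LinearMap.mul' A A).compAlternatingMap (α.domCoprod β)).domDomCongr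
    (finSumFinEquiv.trans (finCongr h))

theorem wedge_apply {p q m : ℕ} (h : p + q = m) (α : DForm A p) (β : DForm A q)
    (v : Fin m → VField A) :
    (p.factorial * q.factorial) • wedge h α β v =
      ∑ σ : Equiv.Perm (Fin m), Equiv.Perm.sign σ •
        (α (fun i => v (σ (Fin.cast h (Fin.castAdd q i)))) *
          β (fun i => v (σ (Fin.cast h (Fin.natAdd p i))))) := by
  subst h
  have := MultilinearMap.domCoprod_alternization_eq α β
  simp only [Fintype.card_fin] at this
  have h2 := congrArg (fun γ => LinearMap.mul' A A (γ (fun i => v (finSumFinEquiv i)))) this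
  simp only [AlternatingMap.smul_apply, map_nsmul] at h2
  rw [wedge]
  refine h2.symm.trans ?_
  rw [MultilinearMap.alternatization_apply, map_sum]
  refine Fintype.sum_equiv (Equiv.permCongr finSumFinEquiv) _ _ fun σ => ?_
  simp [Equiv.Perm.sign_permCongr]

theorem sum_perm_cons {m : ℕ} (g : (Fin (m + 1) → VField A) → A) (X : VField A)
    (w : Fin m → VField A) :
    ∑ σ : Equiv.Perm (Fin (m + 1)), Equiv.Perm.sign σ •
        g (fun i => (Matrix.vecCons X w : Fin (m + 1) → VField A) (σ i)) =
      ∑ r : Fin (m + 1), (-1) ^ (r : ℕ) * ∑ τ : Equiv.Perm (Fin m), Equiv.Perm.sign τ •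
        g (r.insertNth X (fun i => w (τ i))) := by
  let φ : Fin (m + 1) × Equiv.Perm (Fin m) → Equiv.Perm (Fin (m + 1)) :=
    fun x => Equiv.Perm.decomposeFin.symm (0, x.2) * Fin.cycleRange x.1
  have hφ : Function.Bijective φ := by
    rw [Fintype.bijective_iff_injective_and_card]
    refine ⟨?_, by simp [Fintype.card_perm, Nat.factorial_succ]⟩
    rintro ⟨r, τ⟩ ⟨r', τ'⟩ h
    have h0 : φ (r, τ) r = 0 := by simp [φ]
    have h1 : φ (r', τ') r' = 0 := by simp [φ]
    have hr : r = r' := (φ (r', τ')).injective (by rw [h1, ← h, h0])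
    subst hr
    have h2 := mul_right_cancel h
    have h3 := Equiv.Perm.decomposeFin.symm.injective h2
    simp only [Prod.mk.injEq, true_and] at h3
    rw [h3]
  rw [← (Equiv.ofBijective φ hφ).sum_comp, Fintype.sum_prod_type]
  refine Finset.sum_congr rfl fun r _ => ?_
  rw [Finset.mul_sum]
  refine Finset.sum_congr rfl fun τ _ => ?_
  have h1 : (fun i => (Matrix.vecCons X w : Fin (m + 1) → VField A)
      ((Equiv.ofBijective φ hφ) (r, τ) i)) = r.insertNth X (fun i => w (τ i)) := by
    rw [← Fin.cons_comp_cycleRange]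
    ext1 i
    simp only [φ, Equiv.ofBijective_apply, Equiv.Perm.mul_apply, Function.comp_apply]
    refine Fin.cases ?_ (fun k => ?_) (r.cycleRange i)
    · simp
    · simp
  rw [h1]
  simp only [φ, Equiv.ofBijective_apply, Equiv.Perm.sign_mul, Fin.sign_cycleRange,
    Equiv.Perm.decomposeFin.symm_sign, if_true, one_mul, Units.smul_def, Units.val_mul,
    Units.val_pow_eq_pow_val, Units.val_neg, Units.val_one, zsmul_eq_mul, Int.cast_mul,
    Int.cast_pow, Int.cast_neg, Int.cast_one]
  ring

theorem curryLeft_wedge_aux {p q m : ℕ} (h : p + q = m + 1) (α : DForm A p) (β : DForm A q)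
    (X : VField A) (w : Fin m → VField A) :
    (p.factorial * q.factorial) • wedge h α β (Matrix.vecCons X w) =
      (∑ i : Fin p, (-1) ^ (i : ℕ) * ∑ τ : Equiv.Perm (Fin m), Equiv.Perm.sign τ •
        (α (fun k => (Fin.cast h (Fin.castAdd q i)).insertNth (α := fun _ => VField A) X
            (fun i => w (τ i)) (Fin.cast h (Fin.castAdd q k))) *
          β (fun k => (Fin.cast h (Fin.castAdd q i)).insertNth (α := fun _ => VField A) X
            (fun i => w (τ i)) (Fin.cast h (Fin.natAdd p k))))) +
      ∑ i : Fin q, (-1) ^ (p + i : ℕ) * ∑ τ : Equiv.Perm (Fin m), Equiv.Perm.sign τ •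
        (α (fun k => (Fin.cast h (Fin.natAdd p i)).insertNth (α := fun _ => VField A) X
            (fun i => w (τ i)) (Fin.cast h (Fin.castAdd q k))) *
          β (fun k => (Fin.cast h (Fin.natAdd p i)).insertNth (α := fun _ => VField A) X
            (fun i => w (τ i)) (Fin.cast h (Fin.natAdd p k)))) := by
  rw [wedge_apply, sum_perm_cons (fun v => α (fun i => v (Fin.cast h (Fin.castAdd q i))) *
          β (fun i => v (Fin.cast h (Fin.natAdd p i)))), ← (finCongr h).sum_comp,
    Fin.sum_univ_add]
  rfl

theorem curryLeft_wedge_left {p q m : ℕ} (h : p + 1 + q = m + 1) (h' : p + q = m)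
    (α : DForm A (p + 1)) (β : DForm A q) (X : VField A) (w : Fin m → VField A) :
    (∑ i : Fin (p + 1), (-1) ^ (i : ℕ) * ∑ τ : Equiv.Perm (Fin m), Equiv.Perm.sign τ •
        (α (fun k => (Fin.cast h (Fin.castAdd q i)).insertNth (α := fun _ => VField A) X
            (fun i => w (τ i)) (Fin.cast h (Fin.castAdd q k))) *
          β (fun k => (Fin.cast h (Fin.castAdd q i)).insertNth (α := fun _ => VField A) X
            (fun i => w (τ i)) (Fin.cast h (Fin.natAdd (p + 1) k))))) =
    ((p + 1).factorial * q.factorial) • wedge h' (α.curryLeft X) β w := by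
  have key : ∀ i : Fin (p + 1), (-1 : A) ^ (i : ℕ) * ∑ τ : Equiv.Perm (Fin m),
      Equiv.Perm.sign τ •
        (α (fun k => (Fin.cast h (Fin.castAdd q i)).insertNth (α := fun _ => VField A) X
            (fun i => w (τ i)) (Fin.cast h (Fin.castAdd q k))) *
          β (fun k => (Fin.cast h (Fin.castAdd q i)).insertNth (α := fun _ => VField A) X
            (fun i => w (τ i)) (Fin.cast h (Fin.natAdd (p + 1) k)))) =
      (p.factorial * q.factorial) • wedge h' (α.curryLeft X) β w := by
    intro i
    rw [wedge_apply, Finset.mul_sum]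
    refine Finset.sum_congr rfl fun τ _ => ?_
    have h1 : (fun k => (Fin.cast h (Fin.castAdd q i)).insertNth (α := fun _ => VField A) X
            (fun i => w (τ i)) (Fin.cast h (Fin.castAdd q k))) =
        i.insertNth X (fun k => w (τ (Fin.cast h' (Fin.castAdd q k)))) := by
      ext1 k
      rcases Fin.eq_self_or_eq_succAbove i k with rfl | ⟨k, rfl⟩
      · simp
      · have : Fin.cast h (Fin.castAdd q (i.succAbove k)) =
            (Fin.cast h (Fin.castAdd q i)).succAbove (Fin.cast h' (Fin.castAdd q k)) := by
          ext; simp only [Fin.succAbove, Fin.lt_def]; split_ifs <;> (simp_all; try omega)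
        rw [this, Fin.insertNth_apply_succAbove, Fin.insertNth_apply_succAbove]
    have h2 : (fun k => (Fin.cast h (Fin.castAdd q i)).insertNth (α := fun _ => VField A) X
            (fun i => w (τ i)) (Fin.cast h (Fin.natAdd (p + 1) k))) =
        (fun k => w (τ (Fin.cast h' (Fin.natAdd p k)))) := by
      ext1 k
      have : Fin.cast h (Fin.natAdd (p + 1) k) =
            (Fin.cast h (Fin.castAdd q i)).succAbove (Fin.cast h' (Fin.natAdd p k)) := by
          have := i.2
          ext; simp only [Fin.succAbove, Fin.lt_def]; split_ifs <;> (simp_all; try omega)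
      rw [this, Fin.insertNth_apply_succAbove]
    rw [h1, h2, AlternatingMap.map_insertNth]
    simp only [AlternatingMap.curryLeft_apply_apply, Units.smul_def, zsmul_eq_mul]
    push_cast
    have h3 : (-1 : A) ^ (i : ℕ) * (-1) ^ (i : ℕ) = 1 := by
      rw [← mul_pow]; simp
    linear_combination (((Equiv.Perm.sign τ : ℤ) : A) *
      α (Matrix.vecCons X fun k => w (τ (Fin.cast h' (Fin.castAdd q k)))) *
      β (fun k => w (τ (Fin.cast h' (Fin.natAdd p k))))) * h3
  rw [Finset.sum_congr rfl fun i _ => key i]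
  simp only [Finset.sum_const, Finset.card_univ, Fintype.card_fin, smul_smul,
    Nat.factorial_succ, mul_assoc]

theorem curryLeft_wedge_right {p q m : ℕ} (h : p + (q + 1) = m + 1) (h' : p + q = m)
    (α : DForm A p) (β : DForm A (q + 1)) (X : VField A) (w : Fin m → VField A) :
    (∑ i : Fin (q + 1), (-1) ^ (p + i : ℕ) * ∑ τ : Equiv.Perm (Fin m), Equiv.Perm.sign τ •
        (α (fun k => (Fin.cast h (Fin.natAdd p i)).insertNth (α := fun _ => VField A) X
            (fun i => w (τ i)) (Fin.cast h (Fin.castAdd (q + 1) k))) *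
          β (fun k => (Fin.cast h (Fin.natAdd p i)).insertNth (α := fun _ => VField A) X
            (fun i => w (τ i)) (Fin.cast h (Fin.natAdd p k))))) =
    (p.factorial * (q + 1).factorial) • ((-1) ^ p * wedge h' α (β.curryLeft X) w) := by
  have key : ∀ i : Fin (q + 1), (-1 : A) ^ (p + i : ℕ) * ∑ τ : Equiv.Perm (Fin m),
      Equiv.Perm.sign τ •
        (α (fun k => (Fin.cast h (Fin.natAdd p i)).insertNth (α := fun _ => VField A) X
            (fun i => w (τ i)) (Fin.cast h (Fin.castAdd (q + 1) k))) *
          β (fun k => (Fin.cast h (Fin.natAdd p i)).insertNth (α := fun _ => VField A) X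
            (fun i => w (τ i)) (Fin.cast h (Fin.natAdd p k)))) =
      (p.factorial * q.factorial) • ((-1) ^ p * wedge h' α (β.curryLeft X) w) := by
    intro i
    rw [← mul_smul_comm, wedge_apply, Finset.mul_sum, Finset.mul_sum]
    refine Finset.sum_congr rfl fun τ _ => ?_
    have h1 : (fun k => (Fin.cast h (Fin.natAdd p i)).insertNth (α := fun _ => VField A) X
            (fun i => w (τ i)) (Fin.cast h (Fin.natAdd p k))) =
        i.insertNth X (fun k => w (τ (Fin.cast h' (Fin.natAdd p k)))) := by
      ext1 k
      rcases Fin.eq_self_or_eq_succAbove i k with rfl | ⟨k, rfl⟩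
      · simp
      · have : Fin.cast h (Fin.natAdd p (i.succAbove k)) =
            (Fin.cast h (Fin.natAdd p i)).succAbove (Fin.cast h' (Fin.natAdd p k)) := by
          ext; simp only [Fin.succAbove, Fin.lt_def]; split_ifs <;> (simp_all; try omega)
        rw [this, Fin.insertNth_apply_succAbove, Fin.insertNth_apply_succAbove]
    have h2 : (fun k => (Fin.cast h (Fin.natAdd p i)).insertNth (α := fun _ => VField A) X
            (fun i => w (τ i)) (Fin.cast h (Fin.castAdd (q + 1) k))) =
        (fun k => w (τ (Fin.cast h' (Fin.castAdd q k)))) := by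
      ext1 k
      have : Fin.cast h (Fin.castAdd (q + 1) k) =
            (Fin.cast h (Fin.natAdd p i)).succAbove (Fin.cast h' (Fin.castAdd q k)) := by
          have := k.2
          ext; simp only [Fin.succAbove, Fin.lt_def]; split_ifs <;> (simp_all; try omega)
      rw [this, Fin.insertNth_apply_succAbove]
    rw [h1, h2, AlternatingMap.map_insertNth]
    simp only [AlternatingMap.curryLeft_apply_apply, Units.smul_def, zsmul_eq_mul]
    push_cast
    have h3 : (-1 : A) ^ (i : ℕ) * (-1) ^ (i : ℕ) = 1 := by
      rw [← mul_pow]; simp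
    rw [pow_add]
    linear_combination ((-1) ^ p * ((Equiv.Perm.sign τ : ℤ) : A) *
      α (fun k => w (τ (Fin.cast h' (Fin.castAdd q k)))) *
      β (Matrix.vecCons X fun k => w (τ (Fin.cast h' (Fin.natAdd p k))))) * h3
  rw [Finset.sum_congr rfl fun i _ => key i]
  simp only [Finset.sum_const, Finset.card_univ, Fintype.card_fin, smul_smul,
    Nat.factorial_succ, ← mul_assoc]
  congr 1
  ring

theorem wedge_add_left {p q m : ℕ} (h : p + q = m) (α α' : DForm A p) (β : DForm A q) :
    wedge h (α + α') β = wedge h α β + wedge h α' β := by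
  ext v
  simp only [wedge, ← AlternatingMap.domCoprod'_apply, TensorProduct.add_tmul, map_add]
  simp

theorem wedge_add_right {p q m : ℕ} (h : p + q = m) (α : DForm A p) (β β' : DForm A q) :
    wedge h α (β + β') = wedge h α β + wedge h α β' := by
  ext v
  simp only [wedge, ← AlternatingMap.domCoprod'_apply, TensorProduct.tmul_add, map_add]
  simp

theorem wedge_smul_left {p q m : ℕ} (h : p + q = m) (f : A) (α : DForm A p) (β : DForm A q) :
    wedge h (f • α) β = f • wedge h α β := by
  ext v
  simp only [wedge, ← AlternatingMap.domCoprod'_apply, ← TensorProduct.smul_tmul', map_smul]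
  simp

theorem wedge_smul_right {p q m : ℕ} (h : p + q = m) (f : A) (α : DForm A p) (β : DForm A q) :
    wedge h α (f • β) = f • wedge h α β := by
  ext v
  simp only [wedge, ← AlternatingMap.domCoprod'_apply, TensorProduct.tmul_smul, map_smul]
  simp

theorem nsmul_cancel {k : ℕ} (hk : k ≠ 0) {a b : A} (h : k • a = k • b) : a = b := by
  have h2 : (k : ℂ) • a = (k : ℂ) • b := by simpa only [Nat.cast_smul_eq_nsmul] using h
  have h3 := congrArg (fun z => (k : ℂ)⁻¹ • z) h2
  simpa [smul_smul, inv_mul_cancel₀ (Nat.cast_ne_zero.mpr hk : (k : ℂ) ≠ 0)] using h3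

theorem fact_ne {p q : ℕ} : p.factorial * q.factorial ≠ 0 :=
  mul_ne_zero (Nat.factorial_ne_zero _) (Nat.factorial_ne_zero _)

theorem curryLeft_wedge_succ_succ {p q m : ℕ} (h : p + 1 + (q + 1) = m + 1)
    (h1 : p + (q + 1) = m) (h2 : p + 1 + q = m)
    (α : DForm A (p + 1)) (β : DForm A (q + 1)) (X : VField A) :
    (wedge h α β).curryLeft X = wedge h1 (α.curryLeft X) β +
      (-1 : A) ^ (p + 1) • wedge h2 α (β.curryLeft X) := by
  ext w
  refine nsmul_cancel (@fact_ne (p + 1) (q + 1)) ?_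
  rw [AlternatingMap.curryLeft_apply_apply, curryLeft_wedge_aux, curryLeft_wedge_left _ h1,
    curryLeft_wedge_right _ h2, ← smul_add]
  simp

theorem curryLeft_wedge_succ_zero {p m : ℕ} (h : p + 1 + 0 = m + 1)
    (h1 : p + 0 = m) (α : DForm A (p + 1)) (β : DForm A 0) (X : VField A) :
    (wedge h α β).curryLeft X = wedge h1 (α.curryLeft X) β := by
  ext w
  refine nsmul_cancel (@fact_ne (p + 1) 0) ?_
  rw [AlternatingMap.curryLeft_apply_apply, curryLeft_wedge_aux, curryLeft_wedge_left _ h1]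
  simp

theorem curryLeft_wedge_zero_succ {q m : ℕ} (h : 0 + (q + 1) = m + 1)
    (h2 : 0 + q = m) (α : DForm A 0) (β : DForm A (q + 1)) (X : VField A) :
    (wedge h α β).curryLeft X = wedge h2 α (β.curryLeft X) := by
  ext w
  refine nsmul_cancel (@fact_ne 0 (q + 1)) ?_
  rw [AlternatingMap.curryLeft_apply_apply, curryLeft_wedge_aux, curryLeft_wedge_right _ h2]
  simp

theorem lieD_wedge {p q m : ℕ} (h : p + q = m) (α : DForm A p) (β : DForm A q) (X : VField A) :
    lieD X (wedge h α β) = wedge h (lieD X α) β + wedge h α (lieD X β) := by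
  ext v
  refine nsmul_cancel (@fact_ne p q) ?_
  rw [lieD_apply, smul_sub, ← Derivation.map_smul_of_tower, Finset.smul_sum,
    AlternatingMap.add_apply, smul_add]
  simp only [wedge_apply]
  rw [Finset.sum_comm, map_sum, ← Finset.sum_sub_distrib, ← Finset.sum_add_distrib]
  refine Finset.sum_congr rfl fun σ _ => ?_
  rw [← Finset.smul_sum]
  simp only [Units.smul_def]
  rw [Derivation.map_smul_of_tower, ← smul_sub, ← smul_add]
  congr 1
  have e : ∑ j : Fin m, α (fun k => Function.update v j ⁅X, v j⁆
          (σ (Fin.cast h (Fin.castAdd q k)))) *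
        β (fun k => Function.update v j ⁅X, v j⁆ (σ (Fin.cast h (Fin.natAdd p k)))) =
      ∑ i : Fin (p + q), α (fun k => Function.update v (σ (Fin.cast h i))
          ⁅X, v (σ (Fin.cast h i))⁆ (σ (Fin.cast h (Fin.castAdd q k)))) *
        β (fun k => Function.update v (σ (Fin.cast h i)) ⁅X, v (σ (Fin.cast h i))⁆
          (σ (Fin.cast h (Fin.natAdd p k)))) :=
    (((finCongr h).trans σ).sum_comp _).symm
  have hinj : Function.Injective (fun i => σ (Fin.cast h i)) :=
    σ.injective.comp (Fin.cast_injective h)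
  rw [e, Fin.sum_univ_add, lieD_apply, lieD_apply]
  have u1 : ∀ (i : Fin p) Z, (fun k => Function.update v (σ (Fin.cast h (Fin.castAdd q i))) Z
      (σ (Fin.cast h (Fin.castAdd q k)))) =
      Function.update (fun k => v (σ (Fin.cast h (Fin.castAdd q k)))) i Z := fun i Z =>
    Function.update_comp_eq_of_injective v (hinj.comp (Fin.castAdd_injective p q)) i Z
  have u2 : ∀ (i : Fin q) Z, (fun k => Function.update v (σ (Fin.cast h (Fin.natAdd p i))) Z
      (σ (Fin.cast h (Fin.natAdd p k)))) =
      Function.update (fun k => v (σ (Fin.cast h (Fin.natAdd p k)))) i Z := fun i Z =>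
    Function.update_comp_eq_of_injective v (hinj.comp (Fin.natAdd_injective q p)) i Z
  have u3 : ∀ (i : Fin p) Z, (fun k => Function.update v (σ (Fin.cast h (Fin.castAdd q i))) Z
      (σ (Fin.cast h (Fin.natAdd p k)))) = fun k => v (σ (Fin.cast h (Fin.natAdd p k))) :=
    fun i Z => by
      ext1 k
      refine Function.update_of_ne (fun hh => ?_) _ _
      have := congrArg Fin.val (hinj hh)
      have := i.2
      simp at *
      omega
  have u4 : ∀ (i : Fin q) Z, (fun k => Function.update v (σ (Fin.cast h (Fin.natAdd p i))) Z
      (σ (Fin.cast h (Fin.castAdd q k)))) = fun k => v (σ (Fin.cast h (Fin.castAdd q k))) :=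
    fun i Z => by
      ext1 k
      refine Function.update_of_ne (fun hh => ?_) _ _
      have := congrArg Fin.val (hinj hh)
      have := k.2
      simp at *
      omega
  simp only [u1, u2, u3, u4, Derivation.leibniz, smul_eq_mul, ← Finset.sum_mul, ← Finset.mul_sum]
  ring

end DForm

instance DForm.instTower (A : Type*) [CommRing A] [Algebra ℂ A] (p : ℕ) :
    IsScalarTower ℂ A (DForm A p) := ⟨fun c f α => by ext v; simp⟩

/-- Differential forms of mixed degree, i.e. sections of `∧^* T^*M ⊗ ℂ`; `α.comp p` is the
component of degree `p`. -/
structure MForm (A : Type*) [CommRing A] [Algebra ℂ A] : Type _ where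
  comp : ∀ p : ℕ, DForm A p

namespace MForm

open DForm

variable {A : Type*} [CommRing A] [Algebra ℂ A]

instance : CoeFun (MForm A) (fun _ => ∀ p : ℕ, DForm A p) := ⟨comp⟩

/-- The bijection through which the componentwise operations are defined. -/
def compEquiv (A : Type*) [CommRing A] [Algebra ℂ A] : MForm A ≃ (∀ p : ℕ, DForm A p) :=
  ⟨comp, mk, fun _ => rfl, fun _ => rfl⟩

instance : AddCommGroup (MForm A) := (compEquiv A).addCommGroup

instance : Module A (MForm A) := (compEquiv A).module A

instance : Module ℂ (MForm A) := (compEquiv A).module ℂ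

theorem ext {α β : MForm A} (h : ∀ p, α p = β p) : α = β :=
  (compEquiv A).injective (funext h)

@[simp] theorem mk_apply (c : ∀ p, DForm A p) (p : ℕ) : (mk c) p = c p := rfl

@[simp] theorem zero_apply (p : ℕ) : (0 : MForm A) p = 0 := rfl

@[simp] theorem add_apply (α β : MForm A) (p : ℕ) : (α + β) p = α p + β p := rfl

@[simp] theorem sub_apply (α β : MForm A) (p : ℕ) : (α - β) p = α p - β p := rfl

@[simp] theorem neg_apply (α : MForm A) (p : ℕ) : (-α) p = -α p := rfl

@[simp] theorem smul_apply (f : A) (α : MForm A) (p : ℕ) : (f • α) p = f • α p := rfl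

@[simp] theorem csmul_apply (c : ℂ) (α : MForm A) (p : ℕ) : (c • α) p = c • α p := rfl

theorem algebraMap_smul_form (c : ℂ) (α : MForm A) : algebraMap ℂ A c • α = c • α :=
  ext fun p => AlternatingMap.ext fun v => by simp [Algebra.smul_def]

/-- A form of degree `p` as a form of mixed degree. -/
def ofDeg (p : ℕ) (α : DForm A p) : MForm A :=
  ⟨fun m => if h : p = m then h ▸ α else 0⟩

theorem ofDeg_same (p : ℕ) (α : DForm A p) : ofDeg p α p = α := by simp [ofDeg]

theorem ofDeg_ne {p m : ℕ} (h : p ≠ m) (α : DForm A p) : ofDeg p α m = 0 := by simp [ofDeg, h]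

/-- The exterior derivative of forms of mixed degree. -/
def d : MForm A →ₗ[ℂ] MForm A where
  toFun α := ⟨fun
    | 0 => 0
    | p + 1 => extD (α p)⟩
  map_add' α β := by
    refine ext fun p => ?_
    ext v
    cases p with
    | zero => simp
    | succ p => simp [extD_apply, koszul_add]
  map_smul' c α := by
    refine ext fun p => ?_
    ext v
    cases p with
    | zero => simp
    | succ p => simp [extD_apply, koszul_csmul]

theorem d_zero (α : MForm A) : d α 0 = 0 := rfl
theorem d_succ (α : MForm A) (p : ℕ) : d α (p + 1) = extD (α p) := rfl

/-- The contraction `i_X`. -/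
def iota (X : VField A) : MForm A →ₗ[A] MForm A where
  toFun α := ⟨fun p => AlternatingMap.curryLeft (α (p + 1)) X⟩
  map_add' _ _ := rfl
  map_smul' _ _ := rfl

/-- The wedge product of forms of mixed degree. -/
def wedge : MForm A →ₗ[A] MForm A →ₗ[A] MForm A :=
  LinearMap.mk₂ A
    (fun α β => ⟨fun m => ∑ x ∈ Finset.HasAntidiagonal.antidiagonal m,
      if h : x.1 + x.2 = m then DForm.wedge h (α x.1) (β x.2) else 0⟩)
    (by
      intro α α' β
      refine ext fun m => ?_
      simp only [add_apply, ← Finset.sum_add_distrib]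
      refine Finset.sum_congr rfl fun x _ => ?_
      split_ifs <;> simp [wedge_add_left])
    (by
      intro f α β
      refine ext fun m => ?_
      simp only [smul_apply, Finset.smul_sum]
      refine Finset.sum_congr rfl fun x _ => ?_
      split_ifs <;> simp [wedge_smul_left])
    (by
      intro α β β'
      refine ext fun m => ?_
      simp only [add_apply, ← Finset.sum_add_distrib]
      refine Finset.sum_congr rfl fun x _ => ?_
      split_ifs <;> simp [wedge_add_right])
    (by
      intro f α β
      refine ext fun m => ?_
      simp only [smul_apply, Finset.smul_sum]
      refine Finset.sum_congr rfl fun x _ => ?_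
      split_ifs <;> simp [wedge_smul_right])

theorem wedge_apply (α β : MForm A) (m : ℕ) : wedge α β m = ∑ x ∈ Finset.HasAntidiagonal.antidiagonal m,
      if h : x.1 + x.2 = m then DForm.wedge h (α x.1) (β x.2) else 0 := rfl

/-- The grading involution, `(-1)^p` on `p`-forms. -/
def invol : MForm A →ₗ[A] MForm A where
  toFun α := ⟨fun p => (-1 : A) ^ p • α p⟩
  map_add' _ _ := by refine ext fun p => ?_; simp
  map_smul' f α := by refine ext fun p => ?_; simp [smul_comm f]

theorem iota_apply (X : VField A) (α : MForm A) (p : ℕ) :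
    iota X α p = AlternatingMap.curryLeft (α (p + 1)) X := rfl

theorem invol_apply (α : MForm A) (p : ℕ) : invol α p = (-1 : A) ^ p • α p := rfl

/-- The Lie derivative of forms of mixed degree. -/
def lie (X : VField A) (α : MForm A) : MForm A := ⟨fun p => lieD X (α p)⟩

theorem lie_wedge (X : VField A) (α β : MForm A) :
    lie X (wedge α β) = wedge (lie X α) β + wedge α (lie X β) := by
  refine ext fun m => ?_
  have hs : lieD X (wedge α β m) = ∑ x ∈ Finset.HasAntidiagonal.antidiagonal m,
      lieD X (if h : x.1 + x.2 = m then DForm.wedge h (α x.1) (β x.2) else 0) := by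
    rw [wedge_apply]
    let L : DForm A m →+ DForm A m :=
      { toFun := lieD X
        map_zero' := by ext; simp [lieD_apply]
        map_add' := fun a b => by ext; simp [lieD_apply, Finset.sum_add_distrib]; ring }
    exact map_sum L _ _
  change lieD X (wedge α β m) = _
  rw [hs, add_apply, wedge_apply, wedge_apply, ← Finset.sum_add_distrib]
  refine Finset.sum_congr rfl fun x hx => ?_
  have h := Finset.HasAntidiagonal.mem_antidiagonal.mp hx
  simp only [dif_pos h]
  exact lieD_wedge _ _ _ _

theorem iota_wedge (X : VField A) (α β : MForm A) :
    iota X (wedge α β) = wedge (iota X α) β + wedge (invol α) (iota X β) := by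
  refine ext fun m => ?_
  let T1 : ℕ × ℕ → DForm A m := fun
    | (0, _) => 0
    | (p + 1, q) => if h : p + q = m then DForm.wedge h (AlternatingMap.curryLeft (α (p + 1)) X) (β q) else 0
  let T2 : ℕ × ℕ → DForm A m := fun
    | (_, 0) => 0
    | (p, q + 1) => if h : p + q = m then
        DForm.wedge h ((-1 : A) ^ p • α p) (AlternatingMap.curryLeft (β (q + 1)) X) else 0
  have hs : AlternatingMap.curryLeft (wedge α β (m + 1)) X = ∑ x ∈ Finset.HasAntidiagonal.antidiagonal (m + 1),
      (T1 x + T2 x) := by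
    rw [wedge_apply]
    let L : DForm A (m + 1) →+ DForm A m :=
      { toFun := fun γ => γ.curryLeft X
        map_zero' := rfl
        map_add' := fun _ _ => rfl }
    refine (map_sum L _ _).trans (Finset.sum_congr rfl fun x hx => ?_)
    have h := Finset.HasAntidiagonal.mem_antidiagonal.mp hx
    rw [dif_pos h]
    change AlternatingMap.curryLeft _ X = _
    obtain ⟨p, q⟩ := x
    dsimp only at h ⊢
    rcases p with _ | p <;> rcases q with _ | q
    · omega
    · simp only [T1, T2, dif_pos (show 0 + q = m by omega), zero_add, pow_zero, one_smul]
      exact curryLeft_wedge_zero_succ _ _ _ _ _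
    · simp only [T1, T2, dif_pos (show p + 0 = m by omega), add_zero]
      exact curryLeft_wedge_succ_zero _ _ _ _ _
    · simp only [T1, T2, dif_pos (show p + (q + 1) = m by omega),
        dif_pos (show p + 1 + q = m by omega), wedge_smul_left]
      exact curryLeft_wedge_succ_succ _ _ _ _ _ _
  change AlternatingMap.curryLeft (wedge α β (m + 1)) X = _
  rw [hs, Finset.sum_add_distrib, Finset.Nat.sum_antidiagonal_succ,
    Finset.Nat.sum_antidiagonal_succ' (f := T2)]
  simp only [T1, T2, zero_add, add_apply, wedge_apply]
  rfl

theorem iota_d (X : VField A) (α : MForm A) : iota X (d α) = lie X α - d (iota X α) := by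
  refine ext fun p => ?_
  cases p with
  | zero => 
    change AlternatingMap.curryLeft (extD (α 0)) X = lieD X (α 0) - 0
    rw [curryLeft_extD_zero, sub_zero]
  | succ p => exact curryLeft_extD_succ _ _

theorem d_invol (α : MForm A) : d (invol α) = - invol (d α) := by
  refine ext fun p => ?_
  cases p with
  | zero => simp [d_zero, invol_apply]
  | succ p =>
    have h : ((-1 : A) ^ p) = algebraMap ℂ A ((-1) ^ p) := by simp
    simp only [invol_apply, neg_apply, d_succ]
    ext v
    simp only [extD_apply, AlternatingMap.neg_apply, AlternatingMap.smul_apply]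
    rw [pow_succ, h, algebraMap_smul, koszul_csmul]
    simp [Algebra.smul_def]

theorem iota_invol (X : VField A) (α : MForm A) : iota X (invol α) = - invol (iota X α) := by
  refine ext fun p => ?_
  ext v
  simp [iota_apply, invol_apply, pow_succ]

theorem invol_invol (α : MForm A) : invol (invol α) = α := by
  refine ext fun p => ?_
  simp [invol_apply, smul_smul, ← mul_pow]

theorem ext_iota {α β : MForm A} {m : ℕ} (h : ∀ X, iota X α m = iota X β m) :
    α (m + 1) = β (m + 1) := by
  ext v
  have := congrArg (fun γ => γ (Matrix.vecTail v)) (h (Matrix.vecHead v))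
  simpa [iota_apply] using this

theorem d_wedge (α β : MForm A) :
    d (wedge α β) = wedge (d α) β + wedge (invol α) (d β) := by
  let D : MForm A → MForm A → MForm A := fun α β =>
    d (wedge α β) - (wedge (d α) β + wedge (invol α) (d β))
  have hD : ∀ X α β, iota X (D α β) = - (D (iota X α) β + D (invol α) (iota X β)) := by
    intro X α β
    simp only [D, map_sub, map_add, iota_d, lie_wedge, iota_wedge, d_invol, iota_invol,
      invol_invol, map_neg, LinearMap.sub_apply, LinearMap.neg_apply]
    abel
  have h0 : ∀ m α β, D α β m = 0 := by
    intro m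
    induction m with
    | zero =>
      intro α β
      have e1 : wedge (d α) β 0 = 0 := by
        rw [wedge_apply]
        simp only [Finset.Nat.antidiagonal_zero, Finset.sum_singleton, d_zero]
        simpa using wedge_smul_left (rfl : 0 + 0 = 0) (0 : A) 0 (β 0)
      have e2 : wedge (invol α) (d β) 0 = 0 := by
        rw [wedge_apply]
        simp only [Finset.Nat.antidiagonal_zero, Finset.sum_singleton, d_zero]
        simpa using wedge_smul_right (rfl : 0 + 0 = 0) (0 : A) (invol α 0) (0 : DForm A 0)
      simp only [D, sub_apply, add_apply, d_zero, e1, e2]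
      simp
    | succ m ih =>
      intro α β
      refine (ext_iota (β := 0) fun X => ?_).trans rfl
      rw [hD, neg_apply, add_apply, ih, ih]
      simp
  refine ext fun m => ?_
  exact sub_eq_zero.mp (h0 m α β)

theorem d_ofDeg {p : ℕ} (α : DForm A p) :
    d (ofDeg p α) = ofDeg (p + 1) (extD α) := by
  refine ext fun m => ?_
  cases m with
  | zero => rw [d_zero, ofDeg_ne (by omega)]
  | succ m =>
    rw [d_succ]
    by_cases h : p = m
    · subst h; rw [ofDeg_same, ofDeg_same]
    · rw [ofDeg_ne h, ofDeg_ne (by omega)]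
      ext v
      simp [extD_apply, koszul_zero]

/-- The closed forms. -/
abbrev Closed (A : Type*) [CommRing A] [Algebra ℂ A] : Submodule ℂ (MForm A) :=
  LinearMap.ker (d (A := A))

/-- De Rham cohomology with complex coefficients, all degrees together: closed forms modulo exact
forms. -/
abbrev Coh (A : Type*) [CommRing A] [Algebra ℂ A] : Type _ :=
  Closed A ⧸ (LinearMap.range (d (A := A))).comap (Closed A).subtype

/-- The cohomology class of a closed form. -/
def cls (α : MForm A) (h : d α = 0) : Coh A := Submodule.Quotient.mk ⟨α, h⟩

/-- The wedge product of closed forms. -/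
def closedWedge : Closed A →ₗ[ℂ] Closed A →ₗ[ℂ] Closed A :=
  LinearMap.mk₂ ℂ
    (fun α β => ⟨wedge α.1 β.1, by
      rw [LinearMap.mem_ker, d_wedge, LinearMap.mem_ker.mp α.2, LinearMap.mem_ker.mp β.2,
        map_zero, map_zero, LinearMap.zero_apply, add_zero]⟩)
    (fun α α' β => Subtype.ext (by
      simp only [Submodule.coe_add, map_add, LinearMap.add_apply]))
    (fun c α β => Subtype.ext (by
      simp only [Submodule.coe_smul, ← algebraMap_smul_form, map_smul, LinearMap.smul_apply]))
    (fun α β β' => Subtype.ext (by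
      simp only [Submodule.coe_add, map_add]))
    (fun c α β => Subtype.ext (by
      simp only [Submodule.coe_smul, ← algebraMap_smul_form, map_smul]))

/-- The product of the cohomology ring, `[α] ∪ [β] = [α ∧ β]`. -/
def cup : Coh A →ₗ[ℂ] Coh A →ₗ[ℂ] Coh A :=
  Submodule.liftQ _
    (LinearMap.mk₂ ℂ
      (fun (α : Closed A) (y : Coh A) =>
        Submodule.mapQ _ _ (closedWedge α) (by
          rintro ⟨β, hβ⟩ ⟨γ, hγ⟩
          refine ⟨wedge (invol α.1) γ, ?_⟩
          have h1 : d (invol α.1) = 0 := by rw [d_invol, LinearMap.mem_ker.mp α.2]; simp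
          have h2 : d γ = β := hγ
          rw [d_wedge, h1, invol_invol, h2, map_zero, LinearMap.zero_apply, zero_add]
          rfl) y)
      (by
        intro α α' y
        induction y using Submodule.Quotient.induction_on with
        | H β => simp only [Submodule.mapQ_apply, map_add, LinearMap.add_apply,
            Submodule.Quotient.mk_add])
      (by
        intro c α y
        induction y using Submodule.Quotient.induction_on with
        | H β => simp only [Submodule.mapQ_apply, map_smul, LinearMap.smul_apply,
            Submodule.Quotient.mk_smul])
      (by intro α y y'; exact map_add _ _ _)
      (by intro c α y; exact map_smul _ _ _))
    (by
      rintro ⟨α, hα⟩ ⟨γ, hγ⟩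
      have h2 : d γ = α := hγ
      rw [LinearMap.mem_ker]
      refine LinearMap.ext fun y => ?_
      induction y using Submodule.Quotient.induction_on with
      | H β =>
        refine (Submodule.Quotient.mk_eq_zero _).mpr ⟨wedge γ β.1, ?_⟩
        rw [d_wedge, h2, LinearMap.mem_ker.mp β.2, map_zero, add_zero]
        rfl)

theorem cup_cls (α β : MForm A) (hα : d α = 0) (hβ : d β = 0) (h : d (wedge α β) = 0) :
    cup (cls α hα) (cls β hβ) = cls (wedge α β) h := rfl

end MForm

instance MForm.instTower (A : Type*) [CommRing A] [Algebra ℂ A] : IsScalarTower ℂ A (MForm A) :=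
  ⟨fun c f α => by
    rw [← MForm.algebraMap_smul_form, smul_smul, Algebra.smul_def]⟩

namespace MForm

variable {A : Type*} [CommRing A] [Algebra ℂ A]

/-- The cohomology classes which have a closed representative in `S`. -/
def classesIn (S : Submodule ℂ (MForm A)) : Submodule ℂ (Coh A) :=
  (S.comap (Closed A).subtype).map (Submodule.mkQ _)

/-- The forms of which only the components of degree in `D` may be nonzero. -/
def degIn (A : Type*) [CommRing A] [Algebra ℂ A] (D : Set ℕ) : Submodule ℂ (MForm A) where
  carrier := {α | ∀ m, m ∉ D → α m = 0}
  add_mem' {α β} hα hβ m hm := by rw [add_apply, hα m hm, hβ m hm, add_zero]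
  zero_mem' _ _ := rfl
  smul_mem' c α hα m hm := by rw [csmul_apply, hα m hm, smul_zero]

/-- `H^k(M, ℂ)` as a subspace of the total cohomology. -/
def cohDeg (A : Type*) [CommRing A] [Algebra ℂ A] (k : ℕ) : Submodule ℂ (Coh A) :=
  classesIn (degIn A {k})

/-- The untwisted (`H = 0`) case of the `ℤ/2`-graded cohomology: classes of closed forms all of
whose components have degree congruent to `k` modulo `2`. -/
def cohPar (A : Type*) [CommRing A] [Algebra ℂ A] (k : ℤ) : Submodule ℂ (Coh A) :=
  classesIn (degIn A {m | (2 : ℤ) ∣ k - m})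

/-- The sum `H^k(M, ℂ) ⊕ H^{k-2}(M, ℂ) ⊕ H^{k-4}(M, ℂ) ⊕ …` inside the total cohomology. -/
def cohBelow (A : Type*) [CommRing A] [Algebra ℂ A] (k : ℤ) : Submodule ℂ (Coh A) :=
  ⨆ (m : ℕ) (_ : (m : ℤ) ≤ k ∧ (2 : ℤ) ∣ k - m), cohDeg A m

/-- The action of `e^{ic} = ∑ⱼ (ic)^j / j!` on the cohomology, for a class `c` of degree `2` on a
manifold of dimension `2n`, where the powers of `c` above the `n`-th vanish. -/
def expCup (n : ℕ) (c : Coh A) : Coh A →ₗ[ℂ] Coh A :=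
  ∑ j ∈ Finset.range (n + 1), (Complex.I ^ j / (j.factorial : ℂ)) • (cup c) ^ j

end MForm

/-- An isomorphism of graded cohomology rings. -/
structure IsCohRingIso {A A' : Type*} [CommRing A] [Algebra ℂ A] [CommRing A'] [Algebra ℂ A']
    (Φ : MForm.Coh A ≃ₗ[ℂ] MForm.Coh A') : Prop where
  map_deg : ∀ k, (MForm.cohDeg A k).map (Φ : MForm.Coh A →ₗ[ℂ] MForm.Coh A') = MForm.cohDeg A' k
  map_cup : ∀ x y, Φ (MForm.cup x y) = MForm.cup (Φ x) (Φ y)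

/-- Complex sections of the generalized tangent bundle `TM ⊕ T^*M`. -/
abbrev GenTangent (A : Type*) [CommRing A] [Algebra ℂ A] : Type _ := VField A × DForm A 1

namespace GenTangent

variable {A : Type*} [CommRing A] [Algebra ℂ A]

/-- The pairing `⟨X + ξ, Y + η⟩ = (ξ(Y) + η(X)) / 2`. -/
def pairing (a b : GenTangent A) : A := (1 / 2 : ℂ) • (a.2 ![b.1] + b.2 ![a.1])

/-- The Dorfman bracket `[X + ξ, Y + η] = [X, Y] + L_X η - i_Y dξ`. -/
def dorfman (a b : GenTangent A) : GenTangent A :=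
  (⁅a.1, b.1⁆, DForm.lieD a.1 b.2 - (DForm.extD a.2).curryLeft b.1)

/-- The Clifford action `(X + ξ) ρ = i_X ρ + ξ ∧ ρ` on forms. -/
def cliff (a : GenTangent A) (ρ : MForm A) : MForm A :=
  MForm.iota a.1 ρ + MForm.wedge (MForm.ofDeg 1 a.2) ρ

/-- The `B`-transform `e^B (X + ξ) = X + ξ + i_X B`. -/
def bTransform (B : DForm A 2) (a : GenTangent A) : GenTangent A :=
  (a.1, a.2 + B.curryLeft a.1)

/-- The `+i`-eigenbundle `L` of `J` (its module of sections). -/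
def eigenL (J : Module.End A (GenTangent A)) : Submodule A (GenTangent A) :=
  Module.End.eigenspace J (algebraMap ℂ A Complex.I)

/-- The `-i`-eigenbundle of `J`; it is identified with `L^*` by the pairing. -/
def eigenLbar (J : Module.End A (GenTangent A)) : Submodule A (GenTangent A) :=
  Module.End.eigenspace J (algebraMap ℂ A (-Complex.I))

/-- The image of `∧^j L^*`, acting by Clifford multiplication on the canonical bundle `K`, the
bundle of forms annihilated by `L`. -/
def cliffPow (J : Module.End A (GenTangent A)) : ℕ → Submodule A (MForm A)
  | 0 => Submodule.span A {ρ | ∀ a ∈ eigenL J, cliff a ρ = 0}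
  | j + 1 => Submodule.span A {τ | ∃ a ∈ eigenLbar J, ∃ ρ ∈ cliffPow J j, cliff a ρ = τ}

/-- The bundle `U_k`, the image of `∧^{k+n} L^* ⊗ K`; so `U_{-n} = K`, and `U_k = 0` for `k < -n`. -/
def U (n : ℕ) (J : Module.End A (GenTangent A)) (k : ℤ) : Submodule A (MForm A) :=
  if 0 ≤ k + n then cliffPow J (k + n).toNat else ⊥

/-- `c` is the decomposition of the form `s` according to `U_{-n} ⊕ ⋯ ⊕ U_n`. -/
def IsDecomposition (n : ℕ) (J : Module.End A (GenTangent A)) (s : MForm A) (c : ℤ → MForm A) :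
    Prop :=
  (∀ k, c k ∈ U n J k) ∧ (∀ k, k ∉ Finset.Icc (-n : ℤ) n → c k = 0) ∧
    ∑ k ∈ Finset.Icc (-n : ℤ) n, c k = s

open Classical in
/-- The component in `U_k` of a form `s`. -/
def proj (n : ℕ) (J : Module.End A (GenTangent A)) (k : ℤ) (s : MForm A) : MForm A :=
  if h : ∃ c, IsDecomposition n J s c then h.choose k else 0

/-- The operator `∂`: on `U_k` it is `d` followed by the projection to `U_{k-1}`. -/
def del (n : ℕ) (J : Module.End A (GenTangent A)) (s : MForm A) : MForm A :=
  ∑ k ∈ Finset.Icc (-n : ℤ) n, proj n J (k - 1) (MForm.d (proj n J k s))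

/-- The operator `∂̄`: on `U_k` it is `d` followed by the projection to `U_{k+1}`. -/
def delbar (n : ℕ) (J : Module.End A (GenTangent A)) (s : MForm A) : MForm A :=
  ∑ k ∈ Finset.Icc (-n : ℤ) n, proj n J (k + 1) (MForm.d (proj n J k s))

/-- The `∂∂̄`-lemma: `Im ∂ ∩ Ker ∂̄ = Im ∂̄ ∩ Ker ∂ = Im ∂∂̄`. -/
def DDbarLemma (n : ℕ) (J : Module.End A (GenTangent A)) : Prop :=
  Set.range (del n J) ∩ {s | delbar n J s = 0} = Set.range (fun s => del n J (delbar n J s)) ∧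
  Set.range (delbar n J) ∩ {s | del n J s = 0} = Set.range (fun s => del n J (delbar n J s))

/-- The Hodge filtration `F^p H(M)`: the classes which have a closed representative that is a sum of
terms in `U_j` with `j ≤ p` and `j ≡ p` modulo `2`. -/
def hodgeF (n : ℕ) (J : Module.End A (GenTangent A)) (p : ℤ) : Submodule ℂ (MForm.Coh A) :=
  MForm.classesIn
    ((⨆ (j : ℤ) (_ : j ≤ p ∧ (2 : ℤ) ∣ p - j), U n J j).restrictScalars ℂ)

end GenTangent

section Manifold

variable (n : ℕ) (M : Type*) [TopologicalSpace M]
  [ChartedSpace (EuclideanSpace ℝ (Fin (2 * n))) M]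

/-- The algebra of smooth complex-valued functions on a manifold of dimension `2n`. -/
def smoothFun : Subalgebra ℂ (M → ℂ) where
  carrier := {f | ContMDiff (𝓡 (2 * n)) 𝓘(ℝ, ℂ) ∞ f}
  mul_mem' {f g} hf hg := by
    have h : ContDiff ℝ ∞ (fun z : ℂ × ℂ => z.1 * z.2) := contDiff_fst.mul contDiff_snd
    exact h.contMDiff.comp (ContMDiff.prodMk_space hf hg)
  add_mem' {f g} hf hg := by
    have h : ContDiff ℝ ∞ (fun z : ℂ × ℂ => z.1 + z.2) := contDiff_fst.add contDiff_snd
    exact h.contMDiff.comp (ContMDiff.prodMk_space hf hg)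
  algebraMap_mem' c := contMDiff_const

/-- `C^∞(M, ℂ)` as a type. -/
abbrev CFun : Type _ := smoothFun n M

variable {n M}

/-- Real-valued functions. -/
def IsRealFun (f : CFun n M) : Prop := ∀ x, ((f : M → ℂ) x).im = 0

/-- Real vector fields: sections of `TM` inside `TM ⊗ ℂ`. -/
def IsRealField (X : VField (CFun n M)) : Prop := ∀ f, IsRealFun f → IsRealFun (X f)

/-- Real differential forms. -/
def IsRealForm {p : ℕ} (α : DForm (CFun n M) p) : Prop :=
  ∀ v, (∀ i, IsRealField (v i)) → IsRealFun (α v)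

/-- `J` is a generalized complex structure on `TM ⊕ T^*M` with the (untwisted) Dorfman bracket. -/
structure IsGeneralizedComplex (J : Module.End (CFun n M) (GenTangent (CFun n M))) : Prop where
  /-- `J` is the complexification of an endomorphism of the real bundle. -/
  real : ∀ a, IsRealField a.1 → IsRealForm a.2 → IsRealField (J a).1 ∧ IsRealForm (J a).2
  /-- `J² = -1`. -/
  sq : ∀ a, J (J a) = -a
  /-- `J` preserves the pairing. -/
  orthogonal : ∀ a b, GenTangent.pairing (J a) (J b) = GenTangent.pairing a b
  /-- The `+i`-eigenbundle is closed under the Dorfman bracket. -/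
  integrable : ∀ a ∈ GenTangent.eigenL J, ∀ b ∈ GenTangent.eigenL J,
    GenTangent.dorfman a b ∈ GenTangent.eigenL J

/-- `J` is of symplectic type: the bivector `ξ ↦ ρ(Jξ)` is an isomorphism from `T^*M` to `TM`. -/
def IsSymplecticType (J : Module.End (CFun n M) (GenTangent (CFun n M))) : Prop :=
  Function.Bijective (fun ξ : DForm (CFun n M) 1 => (J (0, ξ)).1)

/-- `om = ω` and `B` are real `2`-forms, `ω` nondegenerate, with
`J = e^B [[0, -ω⁻¹], [ω, 0]] e^{-B}`. The last equation is evaluated on `e^B (X + ω(Y))`; as `ω` is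
invertible every element is of this form. -/
structure IsSymplecticData (J : Module.End (CFun n M) (GenTangent (CFun n M)))
    (om B : DForm (CFun n M) 2) : Prop where
  real_om : IsRealForm om
  real_B : IsRealForm B
  nondegenerate : Function.Bijective (fun X => om.curryLeft X)
  eq : ∀ X Y : VField (CFun n M),
    J (GenTangent.bTransform B (X, om.curryLeft Y)) =
      GenTangent.bTransform B (-Y, om.curryLeft X)

/-- The form `σ = ω + iB`, as a form of mixed degree. -/
def sigmaForm (om B : DForm (CFun n M) 2) : MForm (CFun n M) :=
  MForm.ofDeg 2 (om + Complex.I • B)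

end Manifold

end

/-! Conjugation by `e^{iσ}` turns the whole structure into ordinary exterior algebra. The
`±i`-eigenbundles of `J` are the graphs of `X ↦ i_X(B ∓ iω)`. Since `[i_X, σ∧] = (i_Xσ)∧` commutes
with `σ∧`, one has `i_X e^{iσ} = e^{iσ}(i_X + i (i_Xσ)∧)`. So, through `e^{iσ}`, the element of `L`
over `X` acts on forms as `i_X`, and the element of `L̄` over `X` acts as `i_X + 2i (i_Xω)∧`
(`cliff_expWedge`).

Hence `K` is `e^{iσ}` times the functions, and `j` Clifford products with `L̄` reach only `e^{iσ}`
times forms of degree `≤ j` and of the parity of `j` (`cliffPow_le`). Conversely, nondegeneracy of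
`ω` makes every `1`-form an `i_Xω`, so exterior multiplication is a Clifford action minus a
contraction, which lowers the degree. Induction on the degree, fed by Euler's identity `m α = ∑ θ_a
∧ i_{e_a} α`, then recovers every form (`expWedge_ofDeg_mem`). The sum of the `U_j` with `j ≤ p`, `j
≡ p` is therefore exactly `e^{iσ}` times the forms of degrees `p+n, p+n-2, …` (`filtU_eq`).

Closure of the graph `L` under the Dorfman bracket says that `d(B - iω) = 0`, that is `dσ = 0`
(`extD_eq_zero`). So `e^{iσ}`, invertible because `σ∧` is nilpotent, commutes with `d`, and the
equality passes to cohomology (`hodgeF_eq`).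

For the existence of `ω` and `B`, let `Q` be the bivector `ξ ↦ ρ(Jξ)`. The required form of `J`
forces `ω = -Q⁻¹` and `B = (T^*-part of J on T^*) ∘ Q⁻¹`. Orthogonality makes both alternating, and
reality of `J` makes both real.

Most of the argument works over any commutative `ℂ`-algebra. The manifold supplies complex
conjugation, the vanishing of forms above degree `2n`, and a finite dual frame (`exists_dualFrame`).
The last two come from the local description of derivations through Hadamard's lemma. -/

namespace MForm

variable {A : Type*} [CommRing A] [Algebra ℂ A]

/-! ### Commutation rules for contraction and exterior multiplication -/

theorem iota_ofDeg_succ {p : ℕ} (X : VField A) (α : DForm A (p + 1)) :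
    iota X (ofDeg (p + 1) α) = ofDeg p (α.curryLeft X) := by
  refine ext fun m => ?_
  rw [iota_apply]
  by_cases h : p = m
  · subst h; rw [ofDeg_same, ofDeg_same]
  · rw [ofDeg_ne h, ofDeg_ne (by omega)]; rfl

theorem iota_ofDeg_zero (X : VField A) (α : DForm A 0) : iota X (ofDeg 0 α) = 0 := by
  refine ext fun m => ?_
  rw [iota_apply, ofDeg_ne (by omega)]; rfl

theorem invol_ofDeg {p : ℕ} (α : DForm A p) : invol (ofDeg p α) = (-1 : A) ^ p • ofDeg p α := by
  refine ext fun m => ?_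
  rw [invol_apply, smul_apply]
  by_cases h : p = m
  · subst h; rfl
  · rw [ofDeg_ne h, smul_zero, smul_zero]

/-- The inclusion of the `p`-forms into the forms of mixed degree. -/
noncomputable def ofDegL (A : Type*) [CommRing A] [Algebra ℂ A] (p : ℕ) : DForm A p →ₗ[A] MForm A where
  toFun := ofDeg p
  map_add' α β := by
    refine ext fun m => ?_
    rw [add_apply]
    by_cases h : p = m
    · subst h; simp only [ofDeg_same]
    · simp only [ofDeg_ne h, add_zero]
  map_smul' f α := by
    refine ext fun m => ?_
    rw [RingHom.id_apply, smul_apply]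
    by_cases h : p = m
    · subst h; simp only [ofDeg_same]
    · simp only [ofDeg_ne h, smul_zero]

theorem ofDeg_add {p : ℕ} (α β : DForm A p) : ofDeg p (α + β) = ofDeg p α + ofDeg p β :=
  map_add (ofDegL A p) α β

theorem ofDeg_smul {p : ℕ} (f : A) (α : DForm A p) : ofDeg p (f • α) = f • ofDeg p α :=
  map_smul (ofDegL A p) f α

theorem ofDeg_zero (p : ℕ) : ofDeg p (0 : DForm A p) = 0 := map_zero (ofDegL A p)

/-- An operator on forms vanishes if it vanishes in degree `0` and commutes with contractions up to
a factor. -/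
theorem linear_eq_zero_of_iota (D : MForm A →ₗ[A] MForm A) (c : A) (h0 : ∀ α, D α 0 = 0)
    (h : ∀ X α, iota X (D α) = c • D (iota X α)) : D = 0 := by
  have key : ∀ m α, D α m = 0 := by
    intro m
    induction m with
    | zero => exact h0
    | succ m ih =>
      intro α
      refine (ext_iota (β := 0) fun X => ?_).trans rfl
      rw [h, smul_apply, ih, smul_zero, map_zero]
      rfl
  exact LinearMap.ext fun α => ext fun m => key m α

theorem wedge_ofDeg_apply_eq_zero {p m : ℕ} (a : DForm A p) (α : MForm A)
    (h : ∀ q, p + q = m → α q = 0) : wedge (ofDeg p a) α m = 0 := by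
  rw [wedge_apply]
  refine Finset.sum_eq_zero fun x hx => ?_
  have hx := Finset.HasAntidiagonal.mem_antidiagonal.mp hx
  rw [dif_pos hx]
  by_cases hp : p = x.1
  · rw [h x.2 (by omega)]
    simpa using DForm.wedge_smul_right hx (0 : A) (ofDeg p a x.1) 0
  · rw [ofDeg_ne hp]
    simpa using DForm.wedge_smul_left hx (0 : A) 0 (α x.2)

theorem wedge_ofDeg_zero (c : DForm A 0) (α : MForm A) : wedge (ofDeg 0 c) α = c ![] • α := by
  have := linear_eq_zero_of_iota (wedge (ofDeg 0 c) - c ![] • LinearMap.id) 1 (fun α => ?_)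
    (fun X α => ?_)
  · exact sub_eq_zero.mp (LinearMap.congr_fun this α)
  · simp only [LinearMap.sub_apply, LinearMap.smul_apply, LinearMap.id_apply, sub_apply,
      smul_apply, wedge_apply, Finset.Nat.antidiagonal_zero, Finset.sum_singleton]
    ext v
    have h := DForm.wedge_apply (rfl : 0 + 0 = 0) (ofDeg 0 c 0) (α 0) v
    simp only [ofDeg_same, Nat.factorial_zero, mul_one, one_smul] at h
    rw [Finset.sum_eq_single 1 (fun b _ hb => absurd
        (Subsingleton.elim (α := Equiv.Perm (Fin 0)) b 1) hb) (by simp),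
      Equiv.Perm.sign_one, one_smul] at h
    simp only [ofDeg_same, dite_true, AlternatingMap.sub_apply,
      AlternatingMap.smul_apply, AlternatingMap.zero_apply, smul_eq_mul, sub_eq_zero]
    rw [h]
    exact congrArg₂ _ (congrArg _ (Subsingleton.elim _ _)) (congrArg _ (Subsingleton.elim _ _))
  · simp only [LinearMap.sub_apply, LinearMap.smul_apply, LinearMap.id_apply, map_sub, map_smul,
      iota_wedge, iota_ofDeg_zero, invol_ofDeg, map_zero, LinearMap.zero_apply, pow_zero, one_smul,
      zero_add]

/-- Exterior multiplication by a `1`-form. -/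
noncomputable def wedge1 (ξ : DForm A 1) : Module.End A (MForm A) := wedge (ofDeg 1 ξ)

/-- Exterior multiplication by a `2`-form. -/
noncomputable def wedge2 (σ : DForm A 2) : Module.End A (MForm A) := wedge (ofDeg 2 σ)

theorem wedge1_add (ξ η : DForm A 1) : wedge1 (ξ + η) = wedge1 ξ + wedge1 η := by
  rw [wedge1, ofDeg_add, map_add]; rfl

theorem wedge1_smul (f : A) (ξ : DForm A 1) : wedge1 (f • ξ) = f • wedge1 ξ := by
  rw [wedge1, ofDeg_smul, map_smul]; rfl

theorem iota_wedge1 (X : VField A) (ξ : DForm A 1) (α : MForm A) :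
    iota X (wedge1 ξ α) = ξ ![X] • α - wedge1 ξ (iota X α) := by
  rw [wedge1, iota_wedge, iota_ofDeg_succ, wedge_ofDeg_zero, invol_ofDeg]
  simp [sub_eq_add_neg]

theorem iota_wedge2 (X : VField A) (σ : DForm A 2) (α : MForm A) :
    iota X (wedge2 σ α) = wedge1 (σ.curryLeft X) α + wedge2 σ (iota X α) := by
  rw [wedge2, iota_wedge, iota_ofDeg_succ, invol_ofDeg, wedge1]
  simp

theorem wedge1_apply_zero (ξ : DForm A 1) (α : MForm A) : wedge1 ξ α 0 = 0 :=
  wedge_ofDeg_apply_eq_zero _ _ fun q hq => by omega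

theorem wedge2_apply_zero (σ : DForm A 2) (α : MForm A) : wedge2 σ α 0 = 0 :=
  wedge_ofDeg_apply_eq_zero _ _ fun q hq => by omega

/-- After contraction with `X` the scalar terms in `ξ(X)` and `η(X)` cancel, which leaves the
anticommutator applied to `i_X α`. The contraction criterion applies with factor `1`. -/
theorem wedge1_anticomm (ξ η : DForm A 1) : wedge1 ξ * wedge1 η + wedge1 η * wedge1 ξ = 0 := by
  refine linear_eq_zero_of_iota _ 1 (fun α => ?_) fun X α => ?_
  · simp [wedge1_apply_zero]
  · simp only [LinearMap.add_apply, Module.End.mul_apply, map_add, iota_wedge1, map_sub, map_smul,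
      one_smul]
    abel

/-- Contraction of the commutator yields the anticommutator of `ξ` with the `1`-form `i_Xσ`, which
vanishes, and minus the commutator on `i_X α`. This explains the factor `-1`. -/
theorem wedge1_comm_wedge2 (ξ : DForm A 1) (σ : DForm A 2) : Commute (wedge1 ξ) (wedge2 σ) := by
  refine sub_eq_zero.mp (linear_eq_zero_of_iota _ (-1) (fun α => ?_) fun X α => ?_)
  · simp [wedge1_apply_zero, wedge2_apply_zero]
  · have h := LinearMap.congr_fun (wedge1_anticomm ξ (σ.curryLeft X)) α
    simp only [LinearMap.add_apply, Module.End.mul_apply, LinearMap.zero_apply] at h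
    simp only [LinearMap.sub_apply, Module.End.mul_apply, map_add, iota_wedge1, map_sub, map_smul,
      iota_wedge2, neg_smul, one_smul]
    rw [eq_neg_of_add_eq_zero_left h]
    abel

theorem iota_mul_wedge2 (X : VField A) (σ : DForm A 2) :
    (iota X : Module.End A (MForm A)) * wedge2 σ =
      wedge2 σ * iota X + wedge1 (σ.curryLeft X) :=
  LinearMap.ext fun α => by
    simp only [LinearMap.add_apply, Module.End.mul_apply, iota_wedge2]; abel

theorem iota_iota (X Y : VField A) (α : MForm A) : iota X (iota Y α) = - iota Y (iota X α) := by
  refine ext fun m => ?_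
  ext v
  simp only [neg_apply, AlternatingMap.neg_apply, iota_apply, AlternatingMap.curryLeft_apply_apply]
  have h := (α (m + 2)).map_swap (Matrix.vecCons X (Matrix.vecCons Y v))
    (i := 0) (j := 1) (by simp)
  rw [← h]
  congr 1
  ext1 i
  refine Fin.cases ?_ (fun i => Fin.cases ?_ (fun i => ?_) i) i
  · simp
  · simp
  · rw [Function.comp_apply, Equiv.swap_apply_of_ne_of_ne (Fin.succ_ne_zero _)
      (fun h => absurd (Fin.succ_inj.mp (h.trans Fin.succ_zero_eq_one.symm)) (Fin.succ_ne_zero _))]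
    simp

/-- Euler's identity for a dual frame. -/
theorem sum_wedge1_iota {ι : Type*} [Fintype ι] (e : ι → VField A) (θ : ι → DForm A 1)
    (hframe : ∀ X, X = ∑ a, θ a ![X] • e a) (m : ℕ) (α : MForm A) :
    (∑ a, wedge1 (θ a) (iota (e a) α)) m = m • α m := by
  have hc : ∀ (f : ι → MForm A) (m : ℕ), (∑ a, f a) m = ∑ a, f a m := fun f m =>
    map_sum (⟨⟨fun γ : MForm A => γ m, rfl⟩, fun _ _ => rfl⟩ : MForm A →+ DForm A m) f _
  induction m generalizing α with
  | zero => simp [hc, wedge1_apply_zero]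
  | succ m ih =>
    refine ext_iota (β := (m + 1) • α) fun X => ?_
    have h1 : iota X α = ∑ a, θ a ![X] • iota (e a) α := by
      conv_lhs => rw [hframe X]
      refine ext fun m => ?_
      simp only [hc, smul_apply, iota_apply, map_sum, map_smul]
    -- The terms `θ_a(X) i_{e_a} α` add up to `i_X α` by the frame identity. The remaining terms
    -- form the Euler sum of `i_X α`, worth `m` by induction, and together they give `m + 1`. Linear
    -- independence of the `e_a` plays no role.
    have h2 : iota X (∑ a, wedge1 (θ a) (iota (e a) α)) =
        iota X α + ∑ a, wedge1 (θ a) (iota (e a) (iota X α)) := by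
      rw [map_sum, h1, ← Finset.sum_add_distrib, ← h1]
      refine Finset.sum_congr rfl fun a _ => ?_
      rw [iota_wedge1, iota_iota X, map_neg, sub_neg_eq_add]
    rw [h2, add_apply, ih, map_nsmul]
    change _ = (m + 1) • iota X α m
    rw [add_smul, one_smul, add_comm]

end MForm

/-! ### The truncated exponential of a nilpotent element -/

/-- The truncated exponential intertwines `x` with `x + i w` if `[x, s] = w` commutes with `s`. -/
theorem mul_truncExp {R : Type*} [Ring R] [Algebra ℂ R] {n : ℕ} {s x w : R}
    (hx : x * s = s * x + w) (hw : Commute w s) (hs : s ^ (n + 1) = 0) :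
    x * (∑ j ∈ Finset.range (n + 1), (Complex.I ^ j / (j.factorial : ℂ)) • s ^ j) =
      (∑ j ∈ Finset.range (n + 1), (Complex.I ^ j / (j.factorial : ℂ)) • s ^ j) *
        (x + Complex.I • w) := by
  have key : ∀ j : ℕ, x * s ^ (j + 1) = s ^ (j + 1) * x + ((j + 1 : ℕ) : ℂ) • (s ^ j * w) := by
    intro j
    induction j with
    | zero => simp [hx]
    | succ j ih =>
      rw [pow_succ s (j + 1), ← mul_assoc, ih, add_mul, mul_assoc _ x, hx, smul_mul_assoc,
        mul_assoc _ w, hw.eq, mul_add, ← mul_assoc, ← mul_assoc, ← pow_succ, add_assoc]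
      congr 1
      rw [Nat.cast_add (j + 1) 1, add_smul, add_comm, ← pow_succ]
      simp
  -- Truncation costs nothing: commuting `x` past `s ^ (n + 1) = 0` gives `(n + 1) s ^ n w = 0`, and
  -- this is the one term by which the two truncated sums would differ.
  have hz : s ^ n * w = 0 := by
    have h := key n
    rw [hs, mul_zero, zero_mul, zero_add] at h
    exact (smul_eq_zero.mp h.symm).resolve_left (Nat.cast_ne_zero.mpr (Nat.succ_ne_zero n))
  rw [mul_add, Finset.sum_mul, mul_smul_comm, Finset.sum_mul, Finset.mul_sum,
    Finset.sum_range_succ', Finset.sum_range_succ' (fun j => _ * x),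
    Finset.sum_range_succ (fun j => _ * w), smul_mul_assoc _ (s ^ n) w, hz, smul_zero, add_zero,
    Finset.smul_sum, add_right_comm, ← Finset.sum_add_distrib]
  congr 1
  · refine Finset.sum_congr rfl fun j _ => ?_
    rw [mul_smul_comm, key, smul_add, smul_mul_assoc, smul_mul_assoc, smul_smul, smul_smul]
    congr 2
    have : ((j + 1 : ℕ) : ℂ) ≠ 0 := Nat.cast_ne_zero.mpr (Nat.succ_ne_zero j)
    have : (j.factorial : ℂ) ≠ 0 := Nat.cast_ne_zero.mpr (Nat.factorial_ne_zero j)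
    rw [Nat.factorial_succ]
    push_cast at *
    field_simp
    ring
  · simp

/-- The constant term is `1`, and the other terms are divisible by the nilpotent `s` with a cofactor
commuting with it. -/
theorem isUnit_truncExp {R : Type*} [Ring R] [Algebra ℂ R] {n : ℕ} {s : R}
    (hs : s ^ (n + 1) = 0) :
    IsUnit (∑ j ∈ Finset.range (n + 1), (Complex.I ^ j / (j.factorial : ℂ)) • s ^ j) := by
  rw [Finset.sum_range_succ']
  simp only [pow_zero, Nat.factorial_zero, Nat.cast_one, div_one, one_smul]
  refine IsNilpotent.isUnit_add_one ?_
  have : ∑ j ∈ Finset.range n, (Complex.I ^ (j + 1) / ((j + 1).factorial : ℂ)) • s ^ (j + 1) =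
      s * ∑ j ∈ Finset.range n, (Complex.I ^ (j + 1) / ((j + 1).factorial : ℂ)) • s ^ j := by
    rw [Finset.mul_sum]
    exact Finset.sum_congr rfl fun j _ => by rw [mul_smul_comm, ← pow_succ' s]
  rw [this]
  refine Commute.isNilpotent_mul_right ?_ ⟨n + 1, hs⟩
  exact Commute.sum_right _ _ _ fun j _ => ((Commute.refl s).pow_right j).smul_right _

/-! ### Multiplication by `e^{iσ}` on forms and on cohomology -/

namespace MForm

variable {A : Type*} [CommRing A] [Algebra ℂ A]

/-- Multiplication by `e^{iσ}`, where the powers of `σ` above the `n`-th are left out. -/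
noncomputable def expWedge (n : ℕ) (σ : DForm A 2) : Module.End A (MForm A) :=
  ∑ j ∈ Finset.range (n + 1), (Complex.I ^ j / (j.factorial : ℂ)) • wedge2 σ ^ j

/-- The forms with components in the degrees `k, k - 2, k - 4, …` only. -/
def belowForms (A : Type*) [CommRing A] [Algebra ℂ A] (k : ℤ) : Submodule A (MForm A) where
  carrier := {α | ∀ m : ℕ, ¬((m : ℤ) ≤ k ∧ (2 : ℤ) ∣ k - m) → α m = 0}
  add_mem' {α β} hα hβ m hm := by rw [add_apply, hα m hm, hβ m hm, add_zero]
  zero_mem' _ _ := rfl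
  smul_mem' c α hα m hm := by rw [smul_apply, hα m hm, smul_zero]

theorem belowForms_mono {k l : ℤ} (h : k ≤ l ∧ (2 : ℤ) ∣ l - k) :
    belowForms A k ≤ belowForms A l := by
  intro α hα m hm
  exact hα m fun h' => hm (by omega)

theorem sum_apply {ι : Type*} (s : Finset ι) (f : ι → MForm A) (m : ℕ) :
    (∑ a ∈ s, f a) m = ∑ a ∈ s, f a m :=
  map_sum (⟨⟨fun γ : MForm A => γ m, rfl⟩, fun _ _ => rfl⟩ : MForm A →+ DForm A m) f _

/-- A form of mixed degree is a family over all degrees, so a finite sum needs the bound `m ≤ k`.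
For negative `k` the range is empty and the form is zero. -/
theorem eq_sum_ofDeg {k : ℤ} {α : MForm A} (hα : α ∈ belowForms A k) :
    α = ∑ m ∈ Finset.range (k + 1).toNat, ofDeg m (α m) := by
  refine ext fun q => ?_
  rw [sum_apply]
  by_cases hq : q ∈ Finset.range (k + 1).toNat
  · rw [Finset.sum_eq_single_of_mem q hq fun m _ hm => ofDeg_ne hm _, ofDeg_same]
  · rw [hα q fun h => hq (by rw [Finset.mem_range]; omega)]
    refine (Finset.sum_eq_zero fun m hm => ofDeg_ne ?_ _).symm
    rintro rfl
    exact hq hm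

theorem iota_mem_belowForms {k : ℤ} (X : VField A) {α : MForm A} (hα : α ∈ belowForms A k) :
    iota X α ∈ belowForms A (k + 1) := by
  intro m hm
  rw [iota_apply, hα (m + 1) fun h => hm (by push_cast at h; omega)]
  rfl

theorem wedge1_mem_belowForms {k : ℤ} (ξ : DForm A 1) {α : MForm A} (hα : α ∈ belowForms A k) :
    wedge1 ξ α ∈ belowForms A (k + 1) := by
  intro m hm
  refine wedge_ofDeg_apply_eq_zero _ _ fun q hq => hα q fun h => hm (by omega)

theorem wedge2_apply_eq_zero (σ : DForm A 2) {α : MForm A} {m : ℕ}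
    (h : ∀ q, 2 + q = m → α q = 0) : wedge2 σ α m = 0 :=
  wedge_ofDeg_apply_eq_zero σ α h

/-- The `j`-th power of `σ∧` has no components below degree `2j`. For `j = n + 1` only degrees above
`2n` are left, and there are no forms there. -/
theorem wedge2_pow_eq_zero {n : ℕ} (hn : ∀ m, 2 * n < m → ∀ α : DForm A m, α = 0)
    (σ : DForm A 2) : wedge2 σ ^ (n + 1) = 0 := by
  have key : ∀ (j m : ℕ) (α : MForm A), m < 2 * j → (wedge2 σ ^ j) α m = 0 := by
    intro j
    induction j with
    | zero => intro m α h; omega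
    | succ j ih =>
      intro m α h
      rw [pow_succ', Module.End.mul_apply]
      exact wedge2_apply_eq_zero σ fun q hq => ih q α (by omega)
  refine LinearMap.ext fun α => ext fun m => ?_
  by_cases h : m < 2 * (n + 1)
  · exact key _ m α h
  · exact hn m (by omega) _

section

variable {n : ℕ} {σ : DForm A 2}

/-- This is the intertwining relation of the truncated exponential with `x = i_X`, `s = σ∧` and `w =
(i_Xσ)∧`. -/
theorem iota_expWedge (hσ : wedge2 σ ^ (n + 1) = 0) (X : VField A) (α : MForm A) :
    iota X (expWedge n σ α) =
      expWedge n σ (iota X α + Complex.I • wedge1 (σ.curryLeft X) α) :=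
  LinearMap.congr_fun (mul_truncExp (iota_mul_wedge2 X σ) (wedge1_comm_wedge2 _ _) hσ) α

theorem wedge1_expWedge (ξ : DForm A 1) (α : MForm A) :
    wedge1 ξ (expWedge n σ α) = expWedge n σ (wedge1 ξ α) :=
  have h : Commute (wedge1 ξ) (expWedge n σ) := Commute.sum_right _ _ _ fun j _ =>
    ((wedge1_comm_wedge2 ξ σ).pow_right j).smul_right (Complex.I ^ j / (j.factorial : ℂ))
  LinearMap.congr_fun h.eq α

theorem expWedge_bijective (hσ : wedge2 σ ^ (n + 1) = 0) :
    Function.Bijective (expWedge n σ) :=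
  (Module.End.isUnit_iff _).mp (isUnit_truncExp hσ)

theorem d_wedge2 (hσ : d (ofDeg 2 σ) = 0) (α : MForm A) : d (wedge2 σ α) = wedge2 σ (d α) := by
  rw [wedge2, d_wedge, hσ, invol_ofDeg]
  simp

theorem d_expWedge (hσ : d (ofDeg 2 σ) = 0) (α : MForm A) :
    d (expWedge n σ α) = expWedge n σ (d α) := by
  have key : ∀ j : ℕ, d ((wedge2 σ ^ j) α) = (wedge2 σ ^ j) (d α) := by
    intro j
    induction j with
    | zero => rfl
    | succ j ih => rw [pow_succ', Module.End.mul_apply, d_wedge2 hσ, ih]; rfl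
  simp only [expWedge, LinearMap.sum_apply, LinearMap.smul_apply, map_sum, map_smul, key]

/-- Links the cohomological operator to the one on forms: powers of the cup product with `[σ]` are
induced by powers of `σ∧` on closed forms. -/
theorem expCup_mk (hσ : d (ofDeg 2 σ) = 0) (x : Closed A) (h : d (expWedge n σ x) = 0) :
    expCup n (cls (ofDeg 2 σ) hσ) (Submodule.Quotient.mk x) =
      Submodule.Quotient.mk ⟨expWedge n σ x, h⟩ := by
  let T : Module.End ℂ (Closed A) := closedWedge ⟨ofDeg 2 σ, hσ⟩
  have h1 : ∀ j : ℕ, ((cup (cls (ofDeg 2 σ) hσ)) ^ j) (Submodule.Quotient.mk x) =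
      Submodule.Quotient.mk ((T ^ j) x) := by
    intro j
    induction j with
    | zero => rfl
    | succ j ih => rw [pow_succ', Module.End.mul_apply, ih, pow_succ']; rfl
  have h2 : ∀ j : ℕ, ((T ^ j) x : MForm A) = (wedge2 σ ^ j) x := by
    intro j
    induction j with
    | zero => rfl
    | succ j ih => rw [pow_succ', pow_succ', Module.End.mul_apply, Module.End.mul_apply, ← ih]; rfl
  have h3 : (⟨expWedge n σ x, h⟩ : Closed A) =
      ∑ j ∈ Finset.range (n + 1), (Complex.I ^ j / (j.factorial : ℂ)) • (T ^ j) x := by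
    refine Subtype.ext ?_
    simp only [expWedge, LinearMap.sum_apply, LinearMap.smul_apply, Submodule.coe_sum,
      Submodule.coe_smul, h2]
  rw [h3, expCup, LinearMap.sum_apply]
  refine Eq.trans ?_ (map_sum (Submodule.mkQ _) _ _).symm
  refine Finset.sum_congr rfl fun j _ => ?_
  rw [LinearMap.smul_apply, h1, map_smul]
  rfl

theorem expWedge_mem_degIn {k : ℤ} {α : MForm A} (hα : α ∈ degIn A {m | (2 : ℤ) ∣ k - m}) :
    expWedge n σ α ∈ degIn A {m | (2 : ℤ) ∣ k - m} := by
  simp only [expWedge, LinearMap.sum_apply, LinearMap.smul_apply]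
  refine Submodule.sum_mem _ fun j hj => Submodule.smul_mem _ _ ?_
  clear hj
  induction j with
  | zero => exact hα
  | succ j ih =>
    rw [pow_succ', Module.End.mul_apply]
    refine fun m hm => wedge2_apply_eq_zero σ fun q hq => ih q fun h => hm ?_
    simp only [Set.mem_ofPred_eq] at h ⊢
    omega

end

/-- As `d` is homogeneous, each component of a closed form is closed, so a class with a
representative in degrees `k, k-2, …` splits into classes of pure degree. -/
theorem cohBelow_eq (k : ℤ) :
    cohBelow A k = classesIn ((belowForms A k).restrictScalars ℂ) := by
  refine le_antisymm (iSup₂_le fun m hm => ?_) ?_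
  · refine Submodule.map_mono (Submodule.comap_mono fun α hα q hq => hα q ?_)
    rintro rfl
    exact hq hm
  · rintro _ ⟨x, hx, rfl⟩
    have hx : (x : MForm A) ∈ belowForms A k := hx
    have hc : ∀ m, d (ofDeg m ((x : MForm A) m)) = 0 := fun m => by
      rw [d_ofDeg, ← d_succ, LinearMap.mem_ker.mp x.2, zero_apply, ofDeg_zero]
    have hs : x = ∑ m ∈ Finset.range (k + 1).toNat,
        (⟨ofDeg m ((x : MForm A) m), hc m⟩ : Closed A) := by
      refine Subtype.ext ?_
      rw [Submodule.coe_sum]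
      exact eq_sum_ofDeg hx
    rw [hs, map_sum]
    refine Submodule.sum_mem _ fun m _ => ?_
    by_cases hm : (m : ℤ) ≤ k ∧ (2 : ℤ) ∣ k - m
    · refine Submodule.mem_iSup_of_mem m (Submodule.mem_iSup_of_mem hm ⟨_, ?_, rfl⟩)
      exact fun q hq => ofDeg_ne (fun h => hq h.symm) _
    · have h0 : (⟨ofDeg m ((x : MForm A) m), hc m⟩ : Closed A) = 0 :=
        Subtype.ext (show ofDeg m ((x : MForm A) m) = 0 by rw [hx m hm, ofDeg_zero])
      rw [h0, map_zero]
      exact Submodule.zero_mem _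

end MForm

/-! ### The eigenbundles of `J` as graphs over `TM`, and closedness of `σ` -/

namespace GenTangent

open MForm

variable {A : Type*} [CommRing A] [Algebra ℂ A] {J : Module.End A (GenTangent A)}
  {om B : DForm A 2} {n : ℕ}

/-- With `a = e^B(X + i_Yω)` one has `Ja = e^B(-Y + i_Xω)`, so `Ja = εa` amounts to `Y = -εX`. The
hypothesis `ε² = -1` covers both eigenvalues `i` and `-i`. -/
theorem mem_eigenspace_iff (hnd : Function.Bijective (fun X => om.curryLeft X))
    (heq : ∀ X Y : VField A, J (bTransform B (X, om.curryLeft Y)) =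
      bTransform B (-Y, om.curryLeft X)) {ε : ℂ} (hε : ε * ε = -1) (a : GenTangent A) :
    a ∈ Module.End.eigenspace J (algebraMap ℂ A ε) ↔
      a.2 = B.curryLeft a.1 - ε • om.curryLeft a.1 := by
  obtain ⟨Y, hY⟩ := hnd.2 (a.2 - B.curryLeft a.1)
  have hY : om.curryLeft Y = a.2 - B.curryLeft a.1 := hY
  have ha : a = bTransform B (a.1, om.curryLeft Y) := by
    rw [hY, bTransform]; simp
  have hJ : J a = bTransform B (-Y, om.curryLeft a.1) := by rw [← heq, ← ha]
  have hl : ∀ (γ : DForm A 2) (X : VField A),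
      γ.curryLeft (ε • X) = ε • γ.curryLeft X := fun γ X => by
    rw [← algebraMap_smul A ε X, map_smul, algebraMap_smul]
  rw [Module.End.mem_eigenspace_iff, hJ, algebraMap_smul]
  constructor
  · intro h
    have h1 : -Y = ε • a.1 := congrArg Prod.fst h
    have h2 : Y = -(ε • a.1) := by rw [← h1, neg_neg]
    have h3 := hY
    rw [h2, map_neg, hl] at h3
    rw [sub_eq_add_neg, h3]
    abel
  · intro h
    have h1 : Y = -(ε • a.1) := hnd.1 (by
      change om.curryLeft Y = om.curryLeft _
      rw [hY, h, map_neg, hl]; abel)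
    rw [bTransform, h1, neg_neg]
    refine Prod.ext rfl ?_
    change om.curryLeft a.1 + B.curryLeft (ε • a.1) = ε • a.2
    rw [h, hl, smul_sub, smul_smul, hε, neg_smul, one_smul]
    abel

/-- For two sections of the graph of `τ = B - iω`, the `T^*`-part of the bracket differs from
`i_{[X,Y]}τ` by `i_Y i_X dτ`. Closure under the bracket is thus `dτ = 0`, and `σ = iτ`. -/
theorem extD_eq_zero (hnd : Function.Bijective (fun X => om.curryLeft X))
    (heq : ∀ X Y : VField A, J (bTransform B (X, om.curryLeft Y)) =
      bTransform B (-Y, om.curryLeft X))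
    (hint : ∀ a ∈ eigenL J, ∀ b ∈ eigenL J, dorfman a b ∈ eigenL J) :
    MForm.d (ofDeg 2 (om + Complex.I • B)) = 0 := by
  set τ : DForm A 2 := B - Complex.I • om with hτ
  have hL : ∀ a, a ∈ eigenL J ↔ a.2 = τ.curryLeft a.1 := fun a =>
    mem_eigenspace_iff hnd heq Complex.I_mul_I a
  have hd : DForm.extD τ = 0 := by
    ext v
    rw [← Matrix.cons_head_tail v, DForm.extD_apply, DForm.koszul_cons]
    set X := Matrix.vecHead v
    set w := Matrix.vecTail v
    rw [← Matrix.cons_head_tail w]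
    set Y := Matrix.vecHead w
    set u := Matrix.vecTail w
    have h := (hL _).mp (hint (X, τ.curryLeft X) ((hL _).mpr rfl) (Y, τ.curryLeft Y)
      ((hL _).mpr rfl))
    have h := congrArg (fun γ : DForm A 1 => γ u) h
    simp only [dorfman, AlternatingMap.sub_apply, AlternatingMap.curryLeft_apply_apply,
      DForm.lieD_apply, DForm.extD_apply] at h
    have h2 : ∀ (k : Fin 1) (Z : VField A),
        Function.update (Matrix.vecCons Y u : Fin 2 → VField A) k.succ Z
        = Matrix.vecCons Y (Function.update u k Z) := fun k Z => by
      rw [Matrix.vecCons, Matrix.vecCons, Fin.cons_update]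
    have h3 : Function.update (Matrix.vecCons Y u : Fin 2 → VField A) 0 ⁅X, Y⁆ =
        Matrix.vecCons ⁅X, Y⁆ u := by
      rw [Matrix.vecCons, Matrix.vecCons, Fin.update_cons_zero]
    rw [DForm.lieD_apply, Fin.sum_univ_succ]
    simp only [h2, Matrix.cons_val_zero, Matrix.cons_val_succ, h3, AlternatingMap.zero_apply]
    rw [← h]
    ring
  have hs : om + Complex.I • B = Complex.I • τ := by
    rw [hτ, smul_sub, smul_smul, Complex.I_mul_I, neg_smul, one_smul, sub_neg_eq_add, add_comm]
  have hd2 : DForm.extD (Complex.I • τ) = 0 := by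
    ext v
    rw [DForm.extD_apply, DForm.koszul_csmul, ← DForm.extD_apply, hd]
    simp
  rw [d_ofDeg, hs, hd2, ofDeg_zero]

/-- The Clifford action as a linear map. -/
noncomputable def cliffL (a : GenTangent A) : MForm A →ₗ[A] MForm A := MForm.iota a.1 + wedge1 a.2

theorem cliffL_apply (a : GenTangent A) (ρ : MForm A) : cliffL a ρ = cliff a ρ := rfl

section

variable (hσ : wedge2 (om + Complex.I • B) ^ (n + 1) = 0)
include hσ

/-- Moving `i_X` past `e^{iσ}` adds `i (i_Xσ)∧ = (i i_Xω - i_XB)∧`. The `B`-terms cancel against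
`a.2`, which leaves the coefficient `i - ε`: zero on `L` and `2i` on `L̄`. -/
theorem cliff_expWedge {ε : ℂ} {a : GenTangent A}
    (ha : a.2 = B.curryLeft a.1 - ε • om.curryLeft a.1) (α : MForm A) :
    cliff a (expWedge n (om + Complex.I • B) α) = expWedge n (om + Complex.I • B)
      (iota a.1 α + (Complex.I - ε) • wedge1 (om.curryLeft a.1) α) := by
  have hw : ∀ (c : ℂ) (ξ : DForm A 1), wedge1 (c • ξ) = c • wedge1 ξ := fun c ξ => by
    rw [← algebraMap_smul A c ξ, wedge1_smul, algebraMap_smul]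
  have h1 : a.2 = B.curryLeft a.1 + (-ε) • om.curryLeft a.1 := by
    rw [ha, sub_eq_add_neg]
    exact congrArg _ (neg_smul _ _).symm
  change iota a.1 _ + wedge1 a.2 _ = _
  rw [iota_expWedge hσ, wedge1_expWedge, ← map_add, h1]
  congr 1
  change _ + Complex.I • wedge1 (om.curryLeft a.1 + Complex.I • B.curryLeft a.1) α + _ = _
  simp only [wedge1_add, hw, LinearMap.add_apply, LinearMap.smul_apply, LinearMap.neg_apply, smul_add, smul_smul,
    Complex.I_mul_I, neg_smul, one_smul, sub_smul]
  abel

end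

end GenTangent

/-! ### The filtration by the `U_j` is `e^{iσ}` times the filtration by degree -/

namespace GenTangent

open MForm

variable {A : Type*} [CommRing A] [Algebra ℂ A] {J : Module.End A (GenTangent A)}
  {om B : DForm A 2} {n : ℕ}

/-- The sum of the `U_j` with `j ≤ p`, `j ≡ p` modulo `2`. -/
def filtU (n : ℕ) (J : Module.End A (GenTangent A)) (p : ℤ) : Submodule A (MForm A) :=
  ⨆ (j : ℤ) (_ : j ≤ p ∧ (2 : ℤ) ∣ p - j), U n J j

theorem U_natCast_sub (n : ℕ) (J : Module.End A (GenTangent A)) (j : ℕ) :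
    U n J ((j : ℤ) - n) = cliffPow J j := by
  rw [U, if_pos (by omega)]
  congr 1
  omega

theorem cliff_mem_U {a : GenTangent A} (ha : a ∈ eigenLbar J) {j : ℤ} {ρ : MForm A}
    (hρ : ρ ∈ U n J j) : cliff a ρ ∈ U n J (j + 1) := by
  unfold U at hρ ⊢
  split_ifs at hρ with h
  · rw [if_pos (by omega), show (j + 1 + n).toNat = (j + n).toNat + 1 by omega]
    exact Submodule.subset_span ⟨a, ha, ρ, hρ, rfl⟩
  · rw [(Submodule.mem_bot _).mp hρ, ← cliffL_apply, map_zero]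
    exact Submodule.zero_mem _

theorem filtU_mono {p q : ℤ} (h : p ≤ q ∧ (2 : ℤ) ∣ q - p) : filtU n J p ≤ filtU n J q :=
  iSup₂_le fun j hj => le_iSup₂_of_le (f := fun j _ => U n J j) j (by omega) le_rfl

theorem cliff_mem_filtU {a : GenTangent A} (ha : a ∈ eigenLbar J) {p : ℤ} {ρ : MForm A}
    (hρ : ρ ∈ filtU n J p) : cliff a ρ ∈ filtU n J (p + 1) := by
  have h : filtU n J p ≤ (filtU n J (p + 1)).comap (cliffL a) := by
    refine iSup₂_le fun j hj τ hτ => ?_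
    exact le_iSup₂_of_le (f := fun j _ => U n J j) (j + 1) (by omega) le_rfl (cliff_mem_U ha hτ)
  exact h hρ

section

variable (hn : ∀ m, 2 * n < m → ∀ α : DForm A m, α = 0)
  (hnd : Function.Bijective (fun X => om.curryLeft X))
  (heq : ∀ X Y : VField A, J (bTransform B (X, om.curryLeft Y)) =
    bTransform B (-Y, om.curryLeft X))
include hn hnd heq

theorem cliffPow_le (j : ℕ) : cliffPow J j ≤
    (belowForms A j).map (expWedge n (om + Complex.I • B)) := by
  have hσ := wedge2_pow_eq_zero hn (om + Complex.I • B)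
  have hbij := expWedge_bijective hσ
  induction j with
  | zero =>
    refine Submodule.span_le.mpr fun ρ hρ => ?_
    obtain ⟨α, rfl⟩ := hbij.2 ρ
    refine ⟨α, fun m hm => ?_, rfl⟩
    cases m with
    | zero => exact absurd ⟨le_rfl, by simp⟩ hm
    | succ m =>
      refine (ext_iota (β := 0) fun X => ?_).trans rfl
      -- Every `X` lifts to a section of `L`, so annihilation of `e^{iσ}α` by `L` means that all
      -- contractions of `α` vanish. Then `α` is a function.
      have ha : ((X, B.curryLeft X - Complex.I • om.curryLeft X) : GenTangent A) ∈ eigenL J :=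
        (mem_eigenspace_iff hnd heq Complex.I_mul_I _).mpr rfl
      have h := hρ _ ha
      rw [cliff_expWedge hσ (ε := Complex.I) rfl, sub_self, zero_smul, add_zero,
        ← map_zero (expWedge n (om + Complex.I • B))] at h
      rw [hbij.1 h, map_zero]
  | succ j ih =>
    refine Submodule.span_le.mpr ?_
    rintro _ ⟨a, ha, ρ, hρ, rfl⟩
    obtain ⟨α, hα, rfl⟩ := ih hρ
    have ha := (mem_eigenspace_iff hnd heq (by simp) a).mp ha
    rw [cliff_expWedge hσ ha]
    refine ⟨_, ?_, rfl⟩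
    rw [Nat.cast_succ]
    refine Submodule.add_mem _ (iota_mem_belowForms _ hα) ?_
    rw [← algebraMap_smul A]
    exact Submodule.smul_mem _ _ (wedge1_mem_belowForms _ hα)

/-- Strong induction on the degree. A function times `e^{iσ}` is annihilated by `L`. A form of
positive degree is, by Euler's identity, a combination of products `θ_a ∧ β` with `β` of degree one
less, and each such product comes from the action of `L̄` on `e^{iσ}β`. -/
theorem expWedge_ofDeg_mem {ι : Type*} [Fintype ι] {e : ι → VField A} {θ : ι → DForm A 1}
    (hframe : ∀ X, X = ∑ a, θ a ![X] • e a) (m : ℕ) (α : DForm A m) :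
    expWedge n (om + Complex.I • B) (ofDeg m α) ∈ filtU n J (m - n) := by
  have hσ := wedge2_pow_eq_zero hn (om + Complex.I • B)
  have hbij := expWedge_bijective hσ
  induction m using Nat.strong_induction_on with
  | _ m ih =>
  have hstep : ∀ (p : ℕ), p < m → ∀ (ξ : DForm A 1) (β : DForm A p),
      (∀ X : VField A, expWedge n (om + Complex.I • B) (iota X (ofDeg p β)) ∈
        filtU n J (p + 1 - n)) →
      expWedge n (om + Complex.I • B) (wedge1 ξ (ofDeg p β)) ∈ filtU n J (p + 1 - n) := by
    intro p hp ξ β hβ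
    obtain ⟨X, hX⟩ := hnd.2 ξ
    have hX : om.curryLeft X = ξ := hX
    have ha : ((X, B.curryLeft X - (-Complex.I) • om.curryLeft X) : GenTangent A) ∈ eigenLbar J :=
      (mem_eigenspace_iff hnd heq (by simp) _).mpr rfl
    have h := cliff_mem_filtU ha (ih p hp β)
    -- With `i_Xω = ξ` the Clifford action gives `e^{iσ}(i_Xβ + 2i ξ∧β)`. The first term lies in the
    -- filtration by assumption, so the second does too, and `2i` is invertible.
    rw [cliff_expWedge hσ (ε := -Complex.I) rfl, map_add, sub_add_eq_add_sub] at h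
    have h2 := (Submodule.add_mem_iff_right _ (hβ X)).mp h
    rw [hX, ← algebraMap_smul A (Complex.I - -Complex.I), map_smul] at h2
    have h3 := Submodule.smul_mem _ (algebraMap ℂ A (Complex.I - -Complex.I)⁻¹) h2
    rwa [smul_smul, ← map_mul, inv_mul_cancel₀, map_one, one_smul] at h3
    rw [sub_neg_eq_add, ← two_mul]
    exact mul_ne_zero two_ne_zero Complex.I_ne_zero
  cases m with
  | zero =>
    refine le_iSup₂_of_le (f := fun j _ => U n J j) ((0 : ℕ) - n : ℤ) (by simp) le_rfl ?_
    rw [U_natCast_sub]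
    refine Submodule.subset_span fun a ha => ?_
    have ha := (mem_eigenspace_iff hnd heq Complex.I_mul_I a).mp ha
    rw [cliff_expWedge hσ ha, iota_ofDeg_zero, sub_self, zero_smul, add_zero, map_zero]
  | succ m =>
    have hE : ofDeg (m + 1) α = algebraMap ℂ A ((m + 1 : ℕ) : ℂ)⁻¹ •
        ∑ a, wedge1 (θ a) (ofDeg m (α.curryLeft (e a))) := by
      have h : ((m + 1 : ℕ) : ℂ) ≠ 0 := Nat.cast_ne_zero.mpr (Nat.succ_ne_zero m)
      have h1 : ∑ a, wedge1 (θ a) (ofDeg m (α.curryLeft (e a))) =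
          ((m + 1 : ℕ) : ℂ) • ofDeg (m + 1) α := by
        simp only [← iota_ofDeg_succ]
        refine ext fun q => ?_
        rw [sum_wedge1_iota e θ hframe, csmul_apply, Nat.cast_smul_eq_nsmul]
        by_cases hq : m + 1 = q
        · subst hq; rfl
        · rw [ofDeg_ne hq, smul_zero, smul_zero]
      rw [h1, algebraMap_smul, smul_smul, inv_mul_cancel₀ h, one_smul]
    rw [hE, map_smul, map_sum]
    refine Submodule.smul_mem _ _ (Submodule.sum_mem _ fun a _ => ?_)
    rw [Nat.cast_succ]
    -- The contraction has degree two below the target, hence the right parity and a smaller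
    -- filtration index. In the lowest case the contraction of a function is zero.
    refine hstep m (Nat.lt_succ_self m) _ _ fun X => ?_
    cases m with
    | zero => rw [iota_ofDeg_zero, map_zero]; exact Submodule.zero_mem _
    | succ m =>
      rw [iota_ofDeg_succ]
      refine filtU_mono ?_ (ih m (by omega) _)
      push_cast
      exact ⟨by linarith, 1, by ring⟩

theorem filtU_eq {ι : Type*} [Fintype ι] {e : ι → VField A} {θ : ι → DForm A 1}
    (hframe : ∀ X, X = ∑ a, θ a ![X] • e a) (p : ℤ) :
    filtU n J p = (belowForms A (p + n)).map (expWedge n (om + Complex.I • B)) := by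
  refine le_antisymm (iSup₂_le fun j hj => ?_) ?_
  · unfold U
    split_ifs with h
    · refine (cliffPow_le hn hnd heq _).trans (Submodule.map_mono (belowForms_mono ?_))
      omega
    · exact bot_le
  · rintro _ ⟨α, hα, rfl⟩
    rw [eq_sum_ofDeg hα, map_sum]
    refine Submodule.sum_mem _ fun m _ => ?_
    by_cases hm : (m : ℤ) ≤ p + n ∧ (2 : ℤ) ∣ p + n - m
    · exact filtU_mono (by omega) (expWedge_ofDeg_mem hn hnd heq hframe m (α m))
    · rw [hα m hm, ofDeg_zero, map_zero]
      exact Submodule.zero_mem _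

/-- Because `e^{iσ}` is injective and commutes with `d`, the form `e^{iσ}α` is closed exactly when
`α` is. Closed representatives on the two sides therefore correspond, and `expCup_mk` compares their
classes. -/
theorem hodgeF_eq {ι : Type*} [Fintype ι] {e : ι → VField A} {θ : ι → DForm A 1}
    (hframe : ∀ X, X = ∑ a, θ a ![X] • e a)
    (hd : d (ofDeg 2 (om + Complex.I • B)) = 0) (p : ℤ) :
    hodgeF n J p = (cohBelow A (p + n)).map
      (expCup n (cls (ofDeg 2 (om + Complex.I • B)) hd)) := by
  have hbij := expWedge_bijective (wedge2_pow_eq_zero hn (om + Complex.I • B))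
  have hF : hodgeF n J p = classesIn ((filtU n J p).restrictScalars ℂ) := rfl
  rw [hF, cohBelow_eq, filtU_eq hn hnd heq hframe]
  refine le_antisymm ?_ ?_
  · rintro _ ⟨⟨_, hx⟩, ⟨α, hα, rfl⟩, rfl⟩
    have h0 : d α = 0 := hbij.1 (by rw [← d_expWedge hd, LinearMap.mem_ker.mp hx, map_zero])
    exact ⟨_, ⟨⟨α, h0⟩, hα, rfl⟩, expCup_mk hd ⟨α, h0⟩ hx⟩
  · rintro _ ⟨_, ⟨x, hx, rfl⟩, rfl⟩
    have h : d (expWedge n (om + Complex.I • B) (x : MForm A)) = 0 := by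
      rw [d_expWedge hd, LinearMap.mem_ker.mp x.2, map_zero]
    exact ⟨⟨_, h⟩, ⟨x, hx, rfl⟩, (expCup_mk hd x h).symm⟩

theorem hodgeF_le_cohPar {ι : Type*} [Fintype ι] {e : ι → VField A} {θ : ι → DForm A 1}
    (hframe : ∀ X, X = ∑ a, θ a ![X] • e a) (p : ℤ) :
    hodgeF n J p ≤ cohPar A (p + n) := by
  have hF : hodgeF n J p = classesIn ((filtU n J p).restrictScalars ℂ) := rfl
  rw [hF, filtU_eq hn hnd heq hframe]
  refine Submodule.map_mono (Submodule.comap_mono ?_)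
  rintro _ ⟨α, hα, rfl⟩
  exact expWedge_mem_degIn fun m hm => hα m fun h => hm h.2

end

end GenTangent

/-! ### Transport along isomorphisms of cohomology rings -/

namespace MForm

variable {A A' : Type*} [CommRing A] [Algebra ℂ A] [CommRing A'] [Algebra ℂ A']

theorem map_cohBelow {Φ : Coh A ≃ₗ[ℂ] Coh A'} (hΦ : IsCohRingIso Φ) (k : ℤ) :
    (cohBelow A k).map (Φ : Coh A →ₗ[ℂ] Coh A') = cohBelow A' k := by
  simp only [cohBelow, Submodule.map_iSup, hΦ.map_deg]

theorem map_expCup {Φ : Coh A ≃ₗ[ℂ] Coh A'} (hΦ : IsCohRingIso Φ) (n : ℕ) (c : Coh A) (x : Coh A) :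
    Φ (expCup n c x) = expCup n (Φ c) (Φ x) := by
  have h : ∀ j : ℕ, Φ ((cup c ^ j) x) = (cup (Φ c) ^ j) (Φ x) := by
    intro j
    induction j with
    | zero => rfl
    | succ j ih =>
      rw [pow_succ', pow_succ', Module.End.mul_apply, Module.End.mul_apply, hΦ.map_cup, ih]
  simp only [expCup, LinearMap.sum_apply, LinearMap.smul_apply, map_sum, map_smul, h]

theorem map_map_expCup {Φ : Coh A ≃ₗ[ℂ] Coh A'} (hΦ : IsCohRingIso Φ) (n : ℕ) (c : Coh A) (k : ℤ) :
    ((cohBelow A k).map (expCup n c)).map (Φ : Coh A →ₗ[ℂ] Coh A') =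
      (cohBelow A' k).map (expCup n (Φ c)) := by
  rw [← map_cohBelow hΦ, ← Submodule.map_comp, ← Submodule.map_comp]
  congr 1
  exact LinearMap.ext fun x => map_expCup hΦ n c x

end MForm

/-! ### Construction of `ω` and `B` from `J` -/

namespace DForm

variable {A : Type*} [CommRing A] [Algebra ℂ A]

/-- A `1`-form from an `A`-linear functional on vector fields. -/
noncomputable def ofLinear (l : VField A →ₗ[A] A) : DForm A 1 :=
  AlternatingMap.ofSubsingleton A (VField A) A 0 l

theorem ofLinear_apply (l : VField A →ₗ[A] A) (v : Fin 1 → VField A) : ofLinear l v = l (v 0) := rfl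

/-- A `2`-form from its contractions. -/
noncomputable def ofContraction (b : VField A →ₗ[A] DForm A 1) (hb : ∀ X, b X ![X] = 0) : DForm A 2 :=
  ofCurry b (by
    rintro X v ⟨i, rfl⟩
    rw [← hb (v i)]
    congr 1
    ext1 j
    rw [Subsingleton.elim i j, Subsingleton.elim j 0]
    rfl)

theorem curryLeft_ofContraction (b : VField A →ₗ[A] DForm A 1) (hb : ∀ X, b X ![X] = 0)
    (X : VField A) : (ofContraction b hb).curryLeft X = b X := by
  ext v
  rw [AlternatingMap.curryLeft_apply_apply, ofContraction, ofCurry_apply]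
  rfl

end DForm

namespace GenTangent

variable {A : Type*} [CommRing A] [Algebra ℂ A] {J : Module.End A (GenTangent A)}

theorem pairing_comm (a b : GenTangent A) : pairing a b = pairing b a := by
  rw [pairing, pairing, add_comm]

theorem pairing_neg (a b : GenTangent A) : pairing a (-b) = -pairing a b := by
  have h : a.2 ![(-b).1] = -a.2 ![b.1] := by
    have h1 := a.2.map_vecCons_smul ![] (-1) b.1
    rwa [neg_one_smul, neg_one_smul] at h1
  rw [pairing, pairing, h, ← smul_neg, neg_add]
  rfl

theorem eq_zero_of_eq_neg {a : A} (h : -a = a) : a = 0 :=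
  DForm.nsmul_cancel two_ne_zero (by rw [two_nsmul, smul_zero]; nth_rw 1 [← h]; simp)

/-- The bivector `ξ ↦ ρ(Jξ)`. -/
def bivector (J : Module.End A (GenTangent A)) : DForm A 1 →ₗ[A] VField A :=
  LinearMap.fst A _ _ ∘ₗ J ∘ₗ LinearMap.inr A _ _

/-- The `T^*`-component of `J` on `T^*`. -/
def cotangentPart (J : Module.End A (GenTangent A)) : DForm A 1 →ₗ[A] DForm A 1 :=
  LinearMap.snd A _ _ ∘ₗ J ∘ₗ LinearMap.inr A _ _

theorem map_zero_prod (ξ : DForm A 1) : J (0, ξ) = (bivector J ξ, cotangentPart J ξ) := rfl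

/-- An orthogonal `J` with `J² = -1` is skew, so `⟨ξ, Jξ⟩ = -⟨ξ, Jξ⟩ = 0`. This is what makes `ω`
alternating. -/
theorem apply_bivector (hsq : ∀ a, J (J a) = -a)
    (horth : ∀ a b, pairing (J a) (J b) = pairing a b) (ξ : DForm A 1) :
    ξ ![bivector J ξ] = 0 := by
  have h := horth (0, ξ) (J (0, ξ))
  rw [hsq, pairing_neg, pairing_comm] at h
  have h := eq_zero_of_eq_neg h
  rw [map_zero_prod, pairing] at h
  have h0 : cotangentPart J ξ ![0] = 0 := AlternatingMap.map_coord_zero _ 0 rfl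
  simp only [h0, add_zero] at h
  simpa using h

/-- `T^*M` is isotropic and `J` preserves the pairing, so `⟨Jξ, Jξ⟩ = 0`. This is what makes `B`
alternating. -/
theorem cotangentPart_apply_bivector
    (horth : ∀ a b, pairing (J a) (J b) = pairing a b) (ξ : DForm A 1) :
    cotangentPart J ξ ![bivector J ξ] = 0 := by
  have h := horth (0, ξ) (0, ξ)
  have h0 : ξ ![0] = 0 := AlternatingMap.map_coord_zero _ 0 rfl
  rw [map_zero_prod, pairing, pairing] at h
  simp only [h0, smul_zero, ← two_smul ℂ, smul_smul] at h
  simpa using h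

/-- With `Q` the bivector, take `ω = -Q⁻¹` and let `B` send `Qξ` to the `T^*`-part of `Jξ`. Then
`J(Q⁻¹X) = e^B X`, hence `e^B(X + i_Yω) = J(Q⁻¹X) - Q⁻¹Y`, and `J² = -1` gives the remaining
formula. -/
theorem exists_symplecticData (hsq : ∀ a, J (J a) = -a)
    (horth : ∀ a b, pairing (J a) (J b) = pairing a b)
    (hbij : Function.Bijective (bivector J)) :
    ∃ om B : DForm A 2, Function.Bijective (fun X => om.curryLeft X) ∧
      (∀ X Y : VField A, J (bTransform B (X, om.curryLeft Y)) =
        bTransform B (-Y, om.curryLeft X)) ∧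
      ∀ ξ, om.curryLeft (bivector J ξ) = -ξ ∧
        B.curryLeft (bivector J ξ) = cotangentPart J ξ := by
  let Q := LinearEquiv.ofBijective _ hbij
  have hQ : ∀ X, bivector J (Q.symm X) = X := Q.apply_symm_apply
  have hQ' : ∀ ξ, Q.symm (bivector J ξ) = ξ := Q.symm_apply_apply
  let om := DForm.ofContraction (-Q.symm.toLinearMap) (fun X => by
    have h := apply_bivector hsq horth (Q.symm X)
    rw [hQ] at h
    change -(Q.symm X ![X]) = 0
    rw [h, neg_zero])
  let B := DForm.ofContraction (cotangentPart J ∘ₗ Q.symm.toLinearMap) (fun X => by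
    have h := cotangentPart_apply_bivector horth (Q.symm X)
    rwa [hQ] at h)
  have hom : ∀ X, om.curryLeft X = -Q.symm X := DForm.curryLeft_ofContraction _ _
  have hB : ∀ X, B.curryLeft X = cotangentPart J (Q.symm X) := DForm.curryLeft_ofContraction _ _
  refine ⟨om, B, ?_, fun X Y => ?_, fun ξ => ⟨by rw [hom, hQ'], by rw [hB, hQ']⟩⟩
  · simp only [hom]
    exact (Equiv.neg _).bijective.comp Q.symm.bijective
  · have h1 : ∀ X, J (0, Q.symm X) = (X, B.curryLeft X) := fun X => by
      rw [map_zero_prod, hQ, hB]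
    have h2 : bTransform B (X, om.curryLeft Y) = J (0, Q.symm X) + -(0, Q.symm Y) := by
      rw [h1, bTransform, hom]
      refine Prod.ext ?_ ?_
      · simp
      · simp [add_comm]
    rw [h2, map_add, map_neg, hsq, h1, bTransform, hom]
    refine Prod.ext ?_ ?_
    · simp
    · simp

end GenTangent

/-! ### Complex conjugation and reality of `ω` and `B` -/

section Real

variable {n : ℕ} {M : Type*} [TopologicalSpace M] [ChartedSpace (EuclideanSpace ℝ (Fin (2 * n))) M]

/-- Complex conjugation of smooth functions. -/
noncomputable def conjFun : CFun n M →+* CFun n M where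
  toFun f := ⟨fun x => (starRingEnd ℂ) ((f : M → ℂ) x), by
    have h : ContDiff ℝ ∞ (fun z : ℂ => Complex.conjCLE z) := Complex.conjCLE.contDiff
    exact h.contMDiff.comp f.2⟩
  map_one' := Subtype.ext (funext fun _ => map_one (starRingEnd ℂ))
  map_mul' _ _ := Subtype.ext (funext fun _ => map_mul (starRingEnd ℂ) _ _)
  map_zero' := Subtype.ext (funext fun _ => map_zero (starRingEnd ℂ))
  map_add' _ _ := Subtype.ext (funext fun _ => map_add (starRingEnd ℂ) _ _)

theorem conjFun_apply (f : CFun n M) (x : M) :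
    (conjFun f : M → ℂ) x = (starRingEnd ℂ) ((f : M → ℂ) x) := rfl

theorem conjFun_conjFun (f : CFun n M) : conjFun (conjFun f) = f :=
  Subtype.ext (funext fun x => by rw [conjFun_apply, conjFun_apply, Complex.conj_conj])

theorem conjFun_smul (c : ℂ) (f : CFun n M) :
    conjFun (c • f) = (starRingEnd ℂ) c • conjFun f :=
  Subtype.ext (funext fun _ => map_mul (starRingEnd ℂ) c _)

theorem isRealFun_iff {f : CFun n M} : IsRealFun f ↔ conjFun f = f := by
  constructor
  · exact fun h => Subtype.ext (funext fun x => Complex.conj_eq_iff_im.mpr (h x))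
  · exact fun h x => Complex.conj_eq_iff_im.mp (by rw [← conjFun_apply, h])

theorem conj_half : (starRingEnd ℂ) (1 / 2) = 1 / 2 := by
  rw [map_div₀, map_one, Complex.conj_ofNat]

theorem conj_neg_half_I : (starRingEnd ℂ) (-Complex.I / 2) = Complex.I / 2 := by
  rw [map_div₀, map_neg, Complex.conj_I, neg_neg, Complex.conj_ofNat]

/-- The real part of an element `a` with conjugate `b`. -/
theorem half_add_eq {V : Type*} [AddCommGroup V] [Module ℂ V] (a b : V) :
    a = (1 / 2 : ℂ) • (a + b) + Complex.I • ((-Complex.I / 2) • (a - b)) := by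
  rw [smul_smul, show Complex.I * (-Complex.I / 2) = 1 / 2 by
    rw [mul_div_assoc', mul_neg, Complex.I_mul_I, neg_neg], ← smul_add, add_add_sub_cancel,
    ← two_smul ℂ, smul_smul]
  norm_num

theorem isRealFun_half_add (f : CFun n M) : IsRealFun ((1 / 2 : ℂ) • (f + conjFun f)) := by
  rw [isRealFun_iff, conjFun_smul, map_add, conjFun_conjFun, add_comm, conj_half]

theorem isRealFun_half_sub (f : CFun n M) :
    IsRealFun ((-Complex.I / 2 : ℂ) • (f - conjFun f)) := by
  rw [isRealFun_iff, conjFun_smul, map_sub, conjFun_conjFun, ← neg_sub f, smul_neg, ← neg_smul,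
    conj_neg_half_I, neg_div]

/-- Reality of `X` concerns real functions only. It is applied to the real and imaginary parts of
`f`, and the two identities are recombined. -/
theorem IsRealField.conjFun_apply {X : VField (CFun n M)} (hX : IsRealField X) (f : CFun n M) :
    X (conjFun f) = conjFun (X f) := by
  have h1 := hX _ (isRealFun_half_add f)
  have h2 := hX _ (isRealFun_half_sub f)
  rw [isRealFun_iff, Derivation.map_smul, conjFun_smul, map_add, map_add, conj_half] at h1
  rw [isRealFun_iff, Derivation.map_smul, conjFun_smul, map_sub, map_sub, conj_neg_half_I] at h2
  have h1' := congrArg (fun z => (2 : ℂ) • z) h1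
  have h2' := congrArg (fun z => (-2 * Complex.I : ℂ) • z) h2
  have hc1 : (2 : ℂ) * (1 / 2) = 1 := by norm_num
  have hc2 : (-2 * Complex.I : ℂ) * (Complex.I / 2) = 1 := by
    linear_combination -Complex.I_mul_I
  have hc3 : (-2 * Complex.I : ℂ) * (-Complex.I / 2) = -1 := by
    linear_combination Complex.I_mul_I
  simp only [smul_smul, hc1, hc2, hc3, one_smul, neg_smul, neg_sub] at h1' h2'
  refine DForm.nsmul_cancel two_ne_zero ?_
  rw [two_nsmul, two_nsmul]
  linear_combination -h1' - h2'

/-- The conjugate vector field. -/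
noncomputable def conjField (X : VField (CFun n M)) : VField (CFun n M) :=
  Derivation.mk'
    { toFun := fun f => conjFun (X (conjFun f))
      map_add' := fun f g => by simp only [map_add]
      map_smul' := fun c f => by
        rw [conjFun_smul, Derivation.map_smul, conjFun_smul, Complex.conj_conj]; rfl }
    (fun f g => by
      change conjFun (X (conjFun (f * g))) = _ • conjFun (X (conjFun g)) +
        _ • conjFun (X (conjFun f))
      simp only [map_mul, Derivation.leibniz, map_add, smul_eq_mul, conjFun_conjFun])

theorem conjField_apply (X : VField (CFun n M)) (f : CFun n M) :
    conjField X f = conjFun (X (conjFun f)) := rfl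

theorem IsRealField.conjField_eq {X : VField (CFun n M)} (hX : IsRealField X) : conjField X = X :=
  Derivation.ext fun f => by rw [conjField_apply, hX.conjFun_apply, conjFun_conjFun]

/-- The conjugate of a `1`-form. -/
noncomputable def conjForm (ξ : DForm (CFun n M) 1) : DForm (CFun n M) 1 :=
  DForm.ofLinear
    { toFun := fun X => conjFun (ξ ![conjField X])
      map_add' := fun X Y => by
        have h : (![conjField (X + Y)] : Fin 1 → VField (CFun n M)) =
            Matrix.vecCons (conjField X + conjField Y) ![] := by
          congr 1
          exact Derivation.ext fun f => by simp [conjField_apply]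
        rw [h, AlternatingMap.map_vecCons_add, map_add]
      map_smul' := fun f X => by
        have h : (![conjField (f • X)] : Fin 1 → VField (CFun n M)) =
            Matrix.vecCons (conjFun f • conjField X) ![] := by
          congr 1
          exact Derivation.ext fun f => by simp [conjField_apply]
        rw [h, AlternatingMap.map_vecCons_smul, smul_eq_mul, map_mul, conjFun_conjFun]
        rfl }

theorem conjForm_apply (ξ : DForm (CFun n M) 1) {v : Fin 1 → VField (CFun n M)}
    (hv : ∀ i, IsRealField (v i)) : conjForm ξ v = conjFun (ξ v) := by
  rw [conjForm, DForm.ofLinear_apply]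
  change conjFun (ξ ![conjField (v 0)]) = _
  rw [(hv 0).conjField_eq]
  congr 2
  ext1 i
  rw [Subsingleton.elim i 0]
  rfl

theorem isRealForm_half_add (ξ : DForm (CFun n M) 1) :
    IsRealForm ((1 / 2 : ℂ) • (ξ + conjForm ξ)) := fun v hv => by
  rw [AlternatingMap.smul_apply, AlternatingMap.add_apply, conjForm_apply ξ hv]
  exact isRealFun_half_add _

theorem isRealForm_half_sub (ξ : DForm (CFun n M) 1) :
    IsRealForm ((-Complex.I / 2 : ℂ) • (ξ - conjForm ξ)) := fun v hv => by
  rw [AlternatingMap.smul_apply, AlternatingMap.sub_apply, conjForm_apply ξ hv]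
  exact isRealFun_half_sub _

theorem IsRealField.of_add {X Y : VField (CFun n M)} (hX : IsRealField X)
    (hXY : IsRealField (X + Y)) : IsRealField Y := fun f hf => by
  have h := isRealFun_iff.mp (hXY f hf)
  rw [Derivation.add_apply, map_add, isRealFun_iff.mp (hX f hf)] at h
  exact isRealFun_iff.mpr (add_left_cancel h)

theorem isRealField_zero : IsRealField (0 : VField (CFun n M)) := fun f _ => by
  rw [isRealFun_iff, Derivation.zero_apply, map_zero]

theorem eq_zero_of_isRealField_smul_I {X : VField (CFun n M)} (hX : IsRealField X)
    (hI : IsRealField (Complex.I • X)) : X = 0 := by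
  refine Derivation.ext fun f => ?_
  have h : conjFun (Complex.I • X f) = Complex.I • X (conjFun f) := (hI.conjFun_apply f).symm
  rw [conjFun_smul, Complex.conj_I, ← hX.conjFun_apply, neg_smul] at h
  have h2 := GenTangent.eq_zero_of_eq_neg h
  have h3 : X (conjFun f) = 0 := (smul_eq_zero.mp h2).resolve_left Complex.I_ne_zero
  rw [hX.conjFun_apply] at h3
  rw [← conjFun_conjFun (X f), h3, map_zero]
  rfl

variable {J : Module.End (CFun n M) (GenTangent (CFun n M))}

/-- Write `ξ = ξ₁ + iξ₂` with `ξ₁`, `ξ₂` real. The bivector is real, so if the image of `ξ` is real,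
the image of `ξ₂` is real and stays real after multiplication by `i`. It vanishes, and `ξ₂ = 0` by
injectivity. -/
theorem isRealForm_of_bivector (hJ : IsGeneralizedComplex J)
    (hbij : Function.Injective (GenTangent.bivector J)) {ξ : DForm (CFun n M) 1}
    (hξ : IsRealField (GenTangent.bivector J ξ)) : IsRealForm ξ := by
  have hreal : ∀ η : DForm (CFun n M) 1, IsRealForm η → IsRealField (GenTangent.bivector J η) :=
    fun η hη => (hJ.real (0, η) isRealField_zero hη).1
  have hdec := half_add_eq ξ (conjForm ξ)
  set ξ₁ := (1 / 2 : ℂ) • (ξ + conjForm ξ) with h₁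
  set ξ₂ := (-Complex.I / 2 : ℂ) • (ξ - conjForm ξ) with h₂
  have hr₁ : IsRealForm ξ₁ := isRealForm_half_add ξ
  have hr₂ : IsRealForm ξ₂ := isRealForm_half_sub ξ
  have h3 : GenTangent.bivector J ξ =
      GenTangent.bivector J ξ₁ + Complex.I • GenTangent.bivector J ξ₂ := by
    rw [← algebraMap_smul (CFun n M), ← map_smul, algebraMap_smul]
    exact (congrArg _ hdec).trans (map_add _ _ _)
  rw [h3] at hξ
  have h4 := eq_zero_of_isRealField_smul_I (hreal _ hr₂) ((hreal _ hr₁).of_add hξ)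
  have h5 : ξ₂ = 0 := hbij (by rw [h4, map_zero])
  rw [hdec, h5, smul_zero, add_zero]
  exact hr₁

theorem exists_isSymplecticData (hJ : IsGeneralizedComplex J) (hsymp : IsSymplecticType J) :
    ∃ om B, IsSymplecticData J om B := by
  have hbij : Function.Bijective (GenTangent.bivector J) := hsymp
  obtain ⟨om, B, hnd, heq, hQ⟩ :=
    GenTangent.exists_symplecticData hJ.sq hJ.orthogonal hbij
  have key : ∀ α : DForm (CFun n M) 2,
      (∀ X, IsRealField X → IsRealForm (α.curryLeft X)) → IsRealForm α := fun α hα v hv => by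
    rw [← Matrix.cons_head_tail v, ← AlternatingMap.curryLeft_apply_apply]
    exact hα _ (hv 0) _ fun i => hv i.succ
  have hinv : ∀ X, IsRealField X → ∃ ξ, GenTangent.bivector J ξ = X ∧ IsRealForm ξ := by
    intro X hX
    obtain ⟨ξ, rfl⟩ := hbij.2 X
    exact ⟨ξ, rfl, isRealForm_of_bivector hJ hbij.1 hX⟩
  refine ⟨om, B, key _ fun X hX => ?_, key _ fun X hX => ?_, hnd, heq⟩
  · obtain ⟨ξ, rfl, hξ⟩ := hinv X hX
    rw [(hQ ξ).1]
    intro v hv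
    have h := isRealFun_iff.mp (hξ v hv)
    rw [isRealFun_iff, AlternatingMap.neg_apply, map_neg, h]
  · obtain ⟨ξ, rfl, hξ⟩ := hinv X hX
    rw [(hQ ξ).2]
    exact (hJ.real (0, ξ) isRealField_zero hξ).2

end Real

/-! ### Hadamard's lemma with a smooth remainder -/

/-- Hadamard's lemma. -/
theorem ContDiff.exists_eq_add_apply_sub {E F : Type*} [NormedAddCommGroup E] [NormedSpace ℝ E]
    [NormedAddCommGroup F] [NormedSpace ℝ F] [CompleteSpace F]
    {f : E → F} (hf : ContDiff ℝ ∞ f) (y : E) :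
    ∃ H : E → E →L[ℝ] F, ContDiff ℝ ∞ H ∧ H y = fderiv ℝ f y ∧
      ∀ u, f u = f y + H u (u - y) := by
  have hf' : ContDiff ℝ ∞ (fderiv ℝ f) := hf.fderiv_right (by simp)
  have hline : ContDiff ℝ ∞ (fun q : E × ℝ => y + q.2 • (q.1 - y)) := by fun_prop
  refine ⟨fun u => ∫ t in (0 : ℝ)..1, fderiv ℝ f (y + t • (u - y)), ?_, ?_, fun u => ?_⟩
  -- Smoothness in `u` is obtained by reading the integral as a convolution over `t`, evaluated at
  -- `0`, of the indicator of `(0, 1]` with a family depending on the parameter `u`. Evaluation at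
  -- `0` accounts for the sign in `-s`. The cutoff `β`, equal to `1` on `[-2, 2]`, supplies compact
  -- support without changing the integral.
  · let β : ContDiffBump (0 : ℝ) := ⟨2, 3, by norm_num, by norm_num⟩
    let φ : ℝ → ℝ := (Set.Ioc (0 : ℝ) 1).indicator 1
    let g : E → ℝ → (E →L[ℝ] F) := fun u s => β s • fderiv ℝ f (y + (-s) • (u - y))
    have hg : ContDiffOn ℝ (⊤ : ℕ∞) ↿g (Set.univ ×ˢ Set.univ) := by
      refine ContDiff.contDiffOn ?_
      have h1 : ContDiff ℝ ∞ (fun q : E × ℝ => β q.2) := β.contDiff.comp contDiff_snd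
      have h2 : ContDiff ℝ ∞ (fun q : E × ℝ => y + (-q.2) • (q.1 - y)) := by fun_prop
      exact h1.smul (hf'.comp h2)
    have hφ : MeasureTheory.LocallyIntegrable φ MeasureTheory.volume := by
      refine MeasureTheory.Integrable.locallyIntegrable ?_
      refine (MeasureTheory.integrable_indicator_iff measurableSet_Ioc).mpr ?_
      exact MeasureTheory.integrableOn_const (by simp)
    have h := MeasureTheory.contDiffOn_convolution_right_with_param (μ := MeasureTheory.volume)
      (ContinuousLinearMap.lsmul ℝ ℝ) (g := g) isOpen_univ
      (isCompact_closedBall (0 : ℝ) 3) (fun u s _ hs => by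
        change β s • _ = _
        rw [β.zero_of_le_dist (le_of_lt (by simpa using hs)), zero_smul]) hφ hg
    rw [Set.univ_prod_univ, contDiffOn_univ] at h
    have h2 := h.comp (contDiff_prodMk_left (0 : ℝ))
    convert h2 using 1
    refine funext fun u => ?_
    rw [Function.comp_apply, MeasureTheory.convolution,
      intervalIntegral.integral_of_le zero_le_one,
      ← MeasureTheory.integral_indicator measurableSet_Ioc]
    refine MeasureTheory.integral_congr_ae (Filter.Eventually.of_forall fun s => ?_)
    by_cases hs : s ∈ Set.Ioc (0 : ℝ) 1
    · have hβ : β (-s) = 1 := β.one_of_mem_closedBall (by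
        have := abs_of_pos hs.1
        simp only [β, mem_closedBall_iff_norm, sub_zero, norm_neg, Real.norm_eq_abs]
        linarith [hs.2])
      simp [φ, g, hs, hβ]
    · simp [φ, hs]
  · simp
  · have hcont : Continuous (fun t : ℝ => fderiv ℝ f (y + t • (u - y))) :=
      hf'.continuous.comp (by fun_prop)
    rw [ContinuousLinearMap.intervalIntegral_apply (hcont.intervalIntegrable _ _),
      intervalIntegral.integral_eq_sub_of_hasDerivAt (f := fun t : ℝ => f (y + t • (u - y)))
        (fun t _ => ?_) ((hcont.clm_apply continuous_const).intervalIntegrable _ _)]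
    · simp
    · have h1 : HasDerivAt (fun t : ℝ => y + t • (u - y)) (u - y) t := by
        simpa using ((hasDerivAt_id t).smul_const (u - y)).const_add y
      exact ((hf.differentiable (by simp)) _).hasFDerivAt.comp_hasDerivAt t h1

/-! ### Derivations of `C^∞(M, ℂ)` in charts, the dimension bound and the dual frame -/

section Frame

variable {n : ℕ} {M : Type*} [TopologicalSpace M] [ChartedSpace (EuclideanSpace ℝ (Fin (2 * n))) M]

/-- Evaluation at a point. -/
def evalAt (x : M) : CFun n M →ₐ[ℂ] ℂ :=
  (Pi.evalAlgHom ℂ (fun _ : M => ℂ) x).comp (smoothFun n M).val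

theorem evalAt_apply (x : M) (f : CFun n M) : evalAt x f = (f : M → ℂ) x := rfl

theorem ext_evalAt {f g : CFun n M} (h : ∀ x, evalAt x f = evalAt x g) : f = g :=
  Subtype.ext (funext h)

/-- The standard basis vector. -/
noncomputable abbrev stdVec (k : Fin (2 * n)) : EuclideanSpace ℝ (Fin (2 * n)) :=
  EuclideanSpace.single k 1

theorem sum_coord_smul_stdVec (u : EuclideanSpace ℝ (Fin (2 * n))) :
    u = ∑ k, u k • (stdVec k : EuclideanSpace ℝ (Fin (2 * n))) := by
  ext j
  simp [stdVec, Pi.single_apply]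

theorem exists_mul_eq_one {f : CFun n M} (hf : ∀ x, evalAt x f ≠ 0) : ∃ g : CFun n M, g * f = 1 := by
  refine ⟨⟨fun x => ((f : M → ℂ) x)⁻¹, fun x => ?_⟩, ext_evalAt fun x => ?_⟩
  · have h : ContDiffAt ℝ ∞ (fun z : ℂ => z⁻¹) ((f : M → ℂ) x) := contDiffAt_inv ℝ (hf x)
    exact h.contMDiffAt.comp x (f.2 x)
  · rw [map_mul, map_one]
    exact inv_mul_cancel₀ (hf x)

section

variable {c : M}

/-- A smooth function in the chart at `c`. -/
noncomputable def inChart (c : M) (f : CFun n M) : EuclideanSpace ℝ (Fin (2 * n)) → ℂ :=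
  (f : M → ℂ) ∘ (extChartAt (𝓡 (2 * n)) c).symm

theorem inChart_apply (f : CFun n M) {x : M} (hx : x ∈ (extChartAt (𝓡 (2 * n)) c).source) :
    inChart c f (extChartAt (𝓡 (2 * n)) c x) = evalAt x f := by
  rw [inChart, Function.comp_apply, (extChartAt (𝓡 (2 * n)) c).left_inv hx, evalAt_apply]

theorem mem_source_of_ne_zero (b : SmoothBumpFunction (𝓡 (2 * n)) c) {x : M} (hx : b x ≠ 0) :
    x ∈ (extChartAt (𝓡 (2 * n)) c).source := by
  rw [extChartAt_source]
  exact b.support_subset_source hx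

/-- The condition on the radii makes `b = 1` on the support of `χ`, so functions cut off by `b` are
unchanged where `χ` is nonzero. -/
theorem exists_nested_bump (c : M) : ∃ b χ : SmoothBumpFunction (𝓡 (2 * n)) c, χ.rOut ≤ b.rIn := by
  let b : SmoothBumpFunction (𝓡 (2 * n)) c := Classical.choice inferInstance
  refine ⟨b, ⟨⟨b.rIn / 2, b.rIn, half_pos b.rIn_pos, half_lt_self b.rIn_pos⟩, ?_⟩, le_rfl⟩
  exact (Set.inter_subset_inter_left _ (Metric.closedBall_subset_closedBall b.rIn_lt_rOut.le)).trans
    b.closedBall_subset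

variable [IsManifold (𝓡 (2 * n)) ∞ M]

theorem contDiffOn_inChart (f : CFun n M) :
    ContDiffOn ℝ ∞ (inChart c f) (extChartAt (𝓡 (2 * n)) c).target :=
  contMDiffOn_iff_contDiffOn.mp
    (f.2.comp_contMDiffOn (contMDiffOn_extChartAt_symm c))

theorem contDiffOn_fderiv_inChart (f : CFun n M) (v : EuclideanSpace ℝ (Fin (2 * n))) :
    ContDiffOn ℝ ∞ (fun u => fderiv ℝ (inChart c f) u v) (extChartAt (𝓡 (2 * n)) c).target :=
  ((contDiffOn_inChart f).fderiv_of_isOpen (isOpen_extChartAt_target c) (by simp)).clm_apply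
    contDiffOn_const

theorem differentiableAt_inChart (f : CFun n M) {x : M}
    (hx : x ∈ (extChartAt (𝓡 (2 * n)) c).source) :
    DifferentiableAt ℝ (inChart c f) (extChartAt (𝓡 (2 * n)) c x) :=
  ((contDiffOn_inChart f).differentiableOn (by simp)).differentiableAt
    ((isOpen_extChartAt_target c).mem_nhds ((extChartAt (𝓡 (2 * n)) c).map_source hx))

/-- Extends `f`, cut off in the chart, to the whole model space, where Hadamard's lemma applies.
Outside the chart target the product vanishes near each point, as the closed ball of the outer
radius lies in the target. -/
theorem contDiff_bump_smul_inChart (b : SmoothBumpFunction (𝓡 (2 * n)) c) (f : CFun n M) :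
    ContDiff ℝ ∞ (fun u => b.toContDiffBump u • inChart c f u) := by
  rw [contDiff_iff_contDiffAt]
  intro u
  by_cases hu : u ∈ (extChartAt (𝓡 (2 * n)) c).target
  · exact b.toContDiffBump.contDiff.contDiffAt.smul
      ((contDiffOn_inChart f).contDiffAt ((isOpen_extChartAt_target c).mem_nhds hu))
  · have hu' : u ∈ (Metric.closedBall (extChartAt (𝓡 (2 * n)) c c) b.rOut)ᶜ := fun h =>
      hu (b.closedBall_subset ⟨h, by simp⟩)
    refine (contDiffAt_const (c := (0 : ℂ))).congr_of_eventuallyEq ?_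
    filter_upwards [Metric.isClosed_closedBall.isOpen_compl.mem_nhds hu'] with w hw
    rw [b.toContDiffBump.zero_of_le_dist (le_of_lt (by simpa using hw)), zero_smul]

variable [T2Space M]

/-- A smooth function on a chart domain, multiplied by a bump function. -/
noncomputable def bumpSmul (b : SmoothBumpFunction (𝓡 (2 * n)) c)
    (g : EuclideanSpace ℝ (Fin (2 * n)) → ℂ)
    (hg : ContDiffOn ℝ ∞ g (extChartAt (𝓡 (2 * n)) c).target) : CFun n M :=
  ⟨fun w => b w • g (extChartAt (𝓡 (2 * n)) c w), by
    refine b.contMDiff_smul ?_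
    refine (contMDiffOn_iff_contDiffOn.mpr hg).comp contMDiffOn_extChartAt fun w hw => ?_
    exact (extChartAt (𝓡 (2 * n)) c).map_source (by rwa [extChartAt_source])⟩

theorem evalAt_bumpSmul (b : SmoothBumpFunction (𝓡 (2 * n)) c)
    (g : EuclideanSpace ℝ (Fin (2 * n)) → ℂ)
    (hg : ContDiffOn ℝ ∞ g (extChartAt (𝓡 (2 * n)) c).target) (x : M) :
    evalAt x (bumpSmul b g hg) = (b x : ℂ) * g (extChartAt (𝓡 (2 * n)) c x) :=
  Complex.real_smul

/-- The partial derivative in a chart, multiplied by a bump function. -/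
noncomputable def partialFun (χ : SmoothBumpFunction (𝓡 (2 * n)) c)
    (v : EuclideanSpace ℝ (Fin (2 * n))) (f : CFun n M) : CFun n M :=
  bumpSmul χ _ (contDiffOn_fderiv_inChart f v)

theorem evalAt_partialFun (χ : SmoothBumpFunction (𝓡 (2 * n)) c)
    (v : EuclideanSpace ℝ (Fin (2 * n))) (f : CFun n M) (x : M) :
    evalAt x (partialFun χ v f) =
      (χ x : ℂ) * fderiv ℝ (inChart c f) (extChartAt (𝓡 (2 * n)) c x) v :=
  evalAt_bumpSmul _ _ _ _

/-- A coordinate vector field, multiplied by a bump function. -/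
noncomputable def partialField (χ : SmoothBumpFunction (𝓡 (2 * n)) c)
    (v : EuclideanSpace ℝ (Fin (2 * n))) : VField (CFun n M) :=
  Derivation.mk'
    { toFun := partialFun χ v
      map_add' := fun f g => by
        refine ext_evalAt fun x => ?_
        rw [map_add, evalAt_partialFun, evalAt_partialFun, evalAt_partialFun, ← mul_add]
        by_cases hx : χ x = 0
        · simp [hx]
        · have hs := mem_source_of_ne_zero χ hx
          have h := ((differentiableAt_inChart f hs).hasFDerivAt.add
            (differentiableAt_inChart g hs).hasFDerivAt).fderiv
          have h2 : inChart c (f + g) = inChart c f + inChart c g := rfl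
          rw [h2, h]
          rfl
      map_smul' := fun a f => by
        refine ext_evalAt fun x => ?_
        rw [RingHom.id_apply, map_smul, evalAt_partialFun, evalAt_partialFun]
        by_cases hx : χ x = 0
        · simp [hx]
        · have hs := mem_source_of_ne_zero χ hx
          have h := ((differentiableAt_inChart f hs).hasFDerivAt.const_smul a).fderiv
          have h2 : inChart c (a • f) = a • inChart c f := rfl
          rw [h2, h, smul_apply, smul_eq_mul, smul_eq_mul]
          ring }
    (fun f g => by
      refine ext_evalAt fun x => ?_
      change evalAt x (partialFun χ v (f * g)) =
        evalAt x (f * partialFun χ v g + g * partialFun χ v f)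
      rw [map_add, map_mul, map_mul, evalAt_partialFun, evalAt_partialFun, evalAt_partialFun]
      by_cases hx : χ x = 0
      · simp [hx]
      · have hs := mem_source_of_ne_zero χ hx
        have h := ((differentiableAt_inChart f hs).hasFDerivAt.mul
          (differentiableAt_inChart g hs).hasFDerivAt).fderiv
        have h2 : inChart c (f * g) = inChart c f * inChart c g := rfl
        rw [h2, h, add_apply, smul_apply,
          smul_apply, inChart_apply f hs, inChart_apply g hs, smul_eq_mul,
          smul_eq_mul]
        ring)

theorem evalAt_partialField (χ : SmoothBumpFunction (𝓡 (2 * n)) c)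
    (v : EuclideanSpace ℝ (Fin (2 * n))) (f : CFun n M) (x : M) :
    evalAt x (partialField χ v f) =
      (χ x : ℂ) * fderiv ℝ (inChart c f) (extChartAt (𝓡 (2 * n)) c x) v :=
  evalAt_partialFun χ v f x

/-- A coordinate function, multiplied by a bump function. -/
noncomputable def coordFun (b : SmoothBumpFunction (𝓡 (2 * n)) c) (k : Fin (2 * n)) : CFun n M :=
  bumpSmul b (fun u => ((u k : ℝ) : ℂ)) (by
    refine ContDiff.contDiffOn (Complex.ofRealCLM.contDiff.comp ?_)
    fun_prop)

theorem evalAt_coordFun (b : SmoothBumpFunction (𝓡 (2 * n)) c) (k : Fin (2 * n)) (x : M) :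
    evalAt x (coordFun b k) = (b x : ℂ) * ((extChartAt (𝓡 (2 * n)) c x k : ℝ) : ℂ) :=
  evalAt_bumpSmul _ _ _ _

/-- A bump function as a complex-valued function. -/
noncomputable def bumpFun (b : SmoothBumpFunction (𝓡 (2 * n)) c) : CFun n M :=
  bumpSmul b (fun _ => 1) contDiffOn_const

theorem evalAt_bumpFun (b : SmoothBumpFunction (𝓡 (2 * n)) c) (x : M) :
    evalAt x (bumpFun b) = (b x : ℂ) := by
  rw [bumpFun, evalAt_bumpSmul, mul_one]

/-- Locally, vector fields are combinations of the coordinate fields. -/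
theorem bump_smul_eq_sum (b χ : SmoothBumpFunction (𝓡 (2 * n)) c) (hχ : χ.rOut ≤ b.rIn)
    (X : VField (CFun n M)) :
    bumpFun χ • X = ∑ k, X (coordFun b k) • partialField χ (stdVec k) := by
  have hone : ∀ x, χ x ≠ 0 → x ∈ (extChartAt (𝓡 (2 * n)) c).source ∧
      extChartAt (𝓡 (2 * n)) c x ∈ Metric.ball (extChartAt (𝓡 (2 * n)) c c) b.rIn ∧ b x = 1 := by
    intro x hx
    have h : x ∈ Function.support χ := hx
    rw [χ.support_eq_inter_preimage] at h
    have hb := Metric.ball_subset_ball hχ h.2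
    exact ⟨mem_source_of_ne_zero χ hx, hb, b.one_of_dist_le h.1 (le_of_lt hb)⟩
  have hχb : bumpFun χ * bumpFun b = bumpFun χ := ext_evalAt fun x => by
    rw [map_mul, evalAt_bumpFun, evalAt_bumpFun]
    by_cases hx : χ x = 0
    · simp [hx]
    · rw [(hone x hx).2.2]; simp
  refine Derivation.ext fun f => ext_evalAt fun x => ?_
  have hsum : (∑ k, X (coordFun b k) • partialField χ (stdVec k)) f =
      ∑ k, X (coordFun b k) * partialField χ (stdVec k) f := by
    rw [← Derivation.coeFnAddMonoidHom_apply, map_sum, Finset.sum_apply]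
    rfl
  rw [hsum, map_sum, Derivation.smul_apply, smul_eq_mul, map_mul, evalAt_bumpFun]
  simp only [map_mul, evalAt_partialField]
  by_cases hx : χ x = 0
  · simp [hx]
  obtain ⟨hs, hball, hb1⟩ := hone x hx
  set φ := extChartAt (𝓡 (2 * n)) c with hφ
  obtain ⟨H, hH, hHy, hf⟩ := (contDiff_bump_smul_inChart b f).exists_eq_add_apply_sub (φ x)
  have hfd : H (φ x) = fderiv ℝ (inChart c f) (φ x) := by
    rw [hHy]
    refine Filter.EventuallyEq.fderiv_eq ?_
    filter_upwards [Metric.isOpen_ball.mem_nhds hball] with w hw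
    rw [b.toContDiffBump.one_of_mem_closedBall (Metric.ball_subset_closedBall hw), one_smul]
  let G : Fin (2 * n) → CFun n M := fun k =>
    bumpSmul b (fun u => H u (stdVec k)) (hH.clm_apply contDiff_const).contDiffOn
  -- Apply `X` to `χ b = χ` and evaluate at `x`, where `b = 1` and `χ ≠ 0`.
  have hXb : evalAt x (X (bumpFun b)) = 0 := by
    have h := congrArg (fun g => evalAt x (X g)) hχb
    simp only [Derivation.leibniz, smul_eq_mul, map_add, map_mul, evalAt_bumpFun, hb1,
      Complex.ofReal_one, one_mul, add_eq_right] at h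
    exact (mul_eq_zero.mp h).resolve_left (by exact_mod_cast hx)
  -- Hadamard's expansion of `b f` about `φ x`, multiplied by `b²`: one extra factor makes the
  -- coordinate differences global functions and the other does this for the coefficients `H(·)
  -- e_k`. Applying `X` at `x`, where `b = 1` and `X b = 0`, leaves `X f = ∑ X(b x_k) ∂_k f`.
  have hdec : bumpFun b * bumpFun b * bumpFun b * f =
      evalAt x f • (bumpFun b * bumpFun b) +
        ∑ k, (coordFun b k - ((φ x k : ℝ) : ℂ) • bumpFun b) * G k := by
    refine ext_evalAt fun w => ?_
    simp only [map_mul, map_add, map_sum, map_sub, map_smul, evalAt_bumpFun, evalAt_coordFun,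
      smul_eq_mul, G, evalAt_bumpSmul]
    by_cases hw : b w = 0
    · simp [hw]
    have hws := mem_source_of_ne_zero b hw
    have h1 := hf (φ w)
    have h2 : b.toContDiffBump (φ w) = b w := by
      rw [b.eqOn_source (by rwa [extChartAt_source] at hws)]
      rfl
    have h3 : b.toContDiffBump (φ x) = b x := by
      rw [b.eqOn_source (by rwa [extChartAt_source] at hs)]
      rfl
    have h4 : H (φ w) (φ w - φ x) = ∑ k, (((φ w k : ℝ) : ℂ) - ((φ x k : ℝ) : ℂ)) *
        H (φ w) (stdVec k) := by
      conv_lhs => rw [sum_coord_smul_stdVec (φ w - φ x)]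
      rw [map_sum]
      refine Finset.sum_congr rfl fun k _ => ?_
      rw [map_smul, Complex.real_smul]
      simp
    rw [h2, h3, hb1, one_smul, inChart_apply f hws, inChart_apply f hs, h4, Complex.real_smul] at h1
    have h5 : ∑ k, ((b w : ℂ) * ((φ w k : ℝ) : ℂ) - ((φ x k : ℝ) : ℂ) * (b w : ℂ)) *
        ((b w : ℂ) * H (φ w) (stdVec k)) = (b w : ℂ) * (b w : ℂ) *
        ∑ k, (((φ w k : ℝ) : ℂ) - ((φ x k : ℝ) : ℂ)) * H (φ w) (stdVec k) := by
      rw [Finset.mul_sum]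
      exact Finset.sum_congr rfl fun k _ => by ring
    rw [h5]
    linear_combination (b w : ℂ) * (b w : ℂ) * h1
  have h := congrArg (fun g => evalAt x (X g)) hdec
  simp only [Derivation.leibniz, smul_eq_mul, map_add, map_mul, map_sum, map_sub, map_smul,
    Derivation.map_smul, evalAt_bumpFun, evalAt_coordFun, hXb, hb1, Complex.ofReal_one, one_mul,
    mul_zero, zero_add, add_zero, sub_zero, G, evalAt_bumpSmul, mul_one] at h
  simp only [← hφ, hfd, sub_self, zero_mul, zero_add] at h
  rw [h, Finset.mul_sum]
  exact Finset.sum_congr rfl fun k _ => by ring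

/-- Near `x` all arguments, scaled by `χ`, are combinations of the same `2n` coordinate fields. By
the pigeonhole principle every term of the expansion has a repeated argument. As `χ = 1` at the
centre `x`, the scaling does not affect the value there. -/
theorem DForm.eq_zero_of_dim_lt {m : ℕ} (hm : 2 * n < m) (α : DForm (CFun n M) m) : α = 0 := by
  ext1 v
  refine ext_evalAt fun x => ?_
  obtain ⟨b, χ, hχ⟩ := exists_nested_bump (n := n) x
  have h : α (fun i => bumpFun χ • v i) = 0 := by
    simp only [bump_smul_eq_sum b χ hχ]
    have h1 := α.toMultilinearMap.map_sum
      (g := fun (i : Fin m) (k : Fin (2 * n)) => v i (coordFun b k) • partialField χ (stdVec k))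
    refine h1.trans (Finset.sum_eq_zero fun r _ => ?_)
    rw [α.toMultilinearMap.map_smul_univ]
    refine (congrArg _ (α.map_eq_zero_of_not_injective _ fun hinj => ?_)).trans (smul_zero _)
    have h2 : Function.Injective r := fun i j hij => hinj (by simp only [hij])
    have := Fintype.card_le_of_injective r h2
    simp only [Fintype.card_fin] at this
    omega
  rw [α.map_smul_univ] at h
  have h2 := congrArg (evalAt x) h
  rw [smul_eq_mul, map_mul, map_prod] at h2
  simpa [evalAt_bumpFun, χ.eq_one] using h2

/-- Finitely many bump functions `χ_c` have supports covering `M`, so `∑ χ_c²` has a smooth inverse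
`g`. The fields `χ_c ∂_k`, with dual forms `X ↦ g χ_c X(b_c x_k)`, reproduce `X` because `∑_k X(b_c
x_k) χ_c ∂_k = χ_c X`. The family is a generating one, in general redundant. -/
theorem exists_dualFrame [CompactSpace M] : ∃ (t : Finset M) (e : t × Fin (2 * n) → VField (CFun n M))
    (θ : t × Fin (2 * n) → DForm (CFun n M) 1),
    ∀ X, X = ∑ a, θ a ![X] • e a := by
  choose b χ hχ using exists_nested_bump (n := n) (M := M)
  obtain ⟨t, ht⟩ := isCompact_univ.elim_finite_subcover (fun c : M => Function.support (χ c))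
    (fun c => (χ c).isOpen_support) (fun c _ => Set.mem_iUnion.mpr ⟨c, (χ c).c_mem_support⟩)
  have hpos : ∀ x, evalAt x (∑ c : t, bumpFun (χ c) * bumpFun (χ c)) ≠ 0 := by
    intro x
    simp only [map_sum, map_mul, evalAt_bumpFun]
    norm_cast
    refine ne_of_gt (Finset.sum_pos' (fun c _ => mul_self_nonneg _) ?_)
    obtain ⟨c, hc, hx⟩ := Set.mem_iUnion₂.mp (ht (Set.mem_univ x))
    exact ⟨⟨c, hc⟩, Finset.mem_univ _, mul_self_pos.mpr hx⟩
  obtain ⟨g, hg⟩ := exists_mul_eq_one hpos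
  refine ⟨t, fun a => partialField (χ a.1) (stdVec a.2),
    fun a => DForm.ofLinear
      { toFun := fun X => g * bumpFun (χ a.1) * X (coordFun (b a.1) a.2)
        map_add' := fun X Y => by rw [Derivation.add_apply, mul_add]
        map_smul' := fun f X => by
          rw [Derivation.smul_apply, RingHom.id_apply, smul_eq_mul, smul_eq_mul]; ring },
    fun X => ?_⟩
  rw [Fintype.sum_prod_type]
  have h : ∀ c : t, ∑ k, (g * bumpFun (χ c) * X (coordFun (b c) k)) •
      partialField (χ c) (stdVec k) = (g * (bumpFun (χ c) * bumpFun (χ c))) • X := fun c => by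
    simp only [mul_smul, ← Finset.smul_sum, ← bump_smul_eq_sum (b c) (χ c) (hχ c)]
  refine Eq.trans ?_ (Finset.sum_congr rfl fun c _ => (h c).symm)
  rw [← Finset.sum_smul, ← Finset.mul_sum, hg, one_smul]

end

end Frame

/-! ### The theorem -/

theorem mainTheorem8 (n : ℕ) (M : Type*) [TopologicalSpace M]
    [ChartedSpace (EuclideanSpace ℝ (Fin (2 * n))) M] [IsManifold (𝓡 (2 * n)) ∞ M]
    [CompactSpace M] [T2Space M]
    (J : Module.End (CFun n M) (GenTangent (CFun n M)))
    (hJ : IsGeneralizedComplex J) (hsymp : IsSymplecticType J)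
    (hdd : GenTangent.DDbarLemma n J) :
    (∃ om B, IsSymplecticData J om B) ∧
    ∀ om B, IsSymplecticData J om B →
      ∃ hσ : MForm.d (sigmaForm om B) = 0,
        (∀ p : ℤ,
          GenTangent.hodgeF n J p ≤ MForm.cohPar (CFun n M) (p + n) ∧
          GenTangent.hodgeF n J p =
            (MForm.cohBelow (CFun n M) (p + n)).map
              (MForm.expCup n (MForm.cls (sigmaForm om B) hσ))) ∧
        (∀ (M' : Type*) [TopologicalSpace M']
          [ChartedSpace (EuclideanSpace ℝ (Fin (2 * n))) M'] [IsManifold (𝓡 (2 * n)) ∞ M']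
          [CompactSpace M'] [T2Space M']
          (J' : Module.End (CFun n M') (GenTangent (CFun n M')))
          (_ : IsGeneralizedComplex J') (_ : IsSymplecticType J')
          (_ : GenTangent.DDbarLemma n J')
          (om' B' : DForm (CFun n M') 2) (_ : IsSymplecticData J' om' B')
          (hσ' : MForm.d (sigmaForm om' B') = 0)
          (Φ : MForm.Coh (CFun n M) ≃ₗ[ℂ] MForm.Coh (CFun n M')) (_ : IsCohRingIso Φ)
          (_ : Φ (MForm.cls (sigmaForm om B) hσ) = MForm.cls (sigmaForm om' B') hσ') (p : ℤ),
          (GenTangent.hodgeF n J p).map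
              (Φ : MForm.Coh (CFun n M) →ₗ[ℂ] MForm.Coh (CFun n M')) =
            GenTangent.hodgeF n J' p) := by
  obtain ⟨t, e, θ, hframe⟩ := exists_dualFrame (n := n) (M := M)
  refine ⟨exists_isSymplecticData hJ hsymp, fun om B h => ?_⟩
  have hdim : ∀ m, 2 * n < m → ∀ α : DForm (CFun n M) m, α = 0 :=
    fun m hm α => DForm.eq_zero_of_dim_lt hm α
  have hd : MForm.d (sigmaForm om B) = 0 :=
    GenTangent.extD_eq_zero h.nondegenerate h.eq hJ.integrable
  have hF : ∀ p : ℤ, GenTangent.hodgeF n J p = (MForm.cohBelow (CFun n M) (p + n)).map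
      (MForm.expCup n (MForm.cls (sigmaForm om B) hd)) :=
    GenTangent.hodgeF_eq hdim h.nondegenerate h.eq hframe hd
  refine ⟨hd, fun p => ⟨GenTangent.hodgeF_le_cohPar hdim h.nondegenerate h.eq hframe p, hF p⟩, ?_⟩
  intro M' _ _ _ _ _ J' _ _ _ om' B' h' hd' Φ hΦ hσ p
  obtain ⟨t', e', θ', hframe'⟩ := exists_dualFrame (n := n) (M := M')
  have hF' : GenTangent.hodgeF n J' p = (MForm.cohBelow (CFun n M') (p + n)).map
      (MForm.expCup n (MForm.cls (sigmaForm om' B') hd')) :=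
    GenTangent.hodgeF_eq (fun m hm α => DForm.eq_zero_of_dim_lt hm α) h'.nondegenerate h'.eq
      hframe' hd' p
  rw [hF, hF', MForm.map_map_expCup hΦ, hσ]
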